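/- Let $d_1 = d_2 \le d_0 \le D_0$, let $\eta_{\mathrm{dec}}, \eta_{\mathrm{enc}}, \beta_1, \beta_2, \sigma_1, \sigma_2 > 0$, put $c := \eta_{\mathrm{dec}}/\eta_{\mathrm{enc}}$, and let $\mathbf Z \in \mathbb{R}^{D_0 \times d_0}$. (For the linear two-latent Markovian hierarchical VAE on data $x \in \mathbb{R}^{D_0}$, $\mathbf Z = \mathbb{E}(x \tilde x^\top)$, where $\tilde x \in \mathbb{R}^{d_0}$ is the whitened input.) For $\mathbf U_1 \in \mathbb{R}^{D_0 \times d_1}$, $\mathbf U_2 \in \mathbb{R}^{d_1 \times d_2}$, $\mathbf V_1 \in \mathbb{R}^{d_1 \times d_0}$, $\mathbf W_2 \in \mathbb{R}^{d_2 \times d_1}$, and with the fixed encoder variances $\mathbf\Sigma_1 = \sigma_1^2 \mathbf I$, $\mathbf\Sigma_2 = \sigma_2^2 \mathbf I$, let \begin{align*} \mathcal{L}_{\mathrm{HVAE}} = \frac{1}{\eta_{\mathrm{dec}}^2} \Big[ & \|\mathbf U_1 \mathbf V_1 - \mathbf Z\|_F^2 + \beta_1 \|(\mathbf U_2 \mathbf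 W_2 - \mathbf I)\mathbf V_1\|_F^2 + \operatorname{tr}(\mathbf U_1^\top \mathbf U_1 \mathbf\Sigma_1) + \beta_1 \operatorname{tr}(\mathbf U_2^\top \mathbf U_2 \mathbf\Sigma_2) \\ & + \beta_1 \operatorname{tr}\big((\mathbf U_2 \mathbf W_2 - \mathbf I)^\top(\mathbf U_2 \mathbf W_2 - \mathbf I)\mathbf\Sigma_1\big) + \beta_2 c^2 \|\mathbf W_2 \mathbf V_1\|_F^2 + \beta_2 c^2 \operatorname{tr}(\mathbf W_2^\top \mathbf W_2 \mathbf\Sigma_1) + \beta_2 c^2 \operatorname{tr}(\mathbf\Sigma_2) \Big] \\ & - \beta_1 \log|\mathbf\Sigma_1| - \beta_2 \log|\mathbf\Sigma_2| . \end{align*} Then $(\mathbf U_1^*, \mathbf U_2^*, \mathbf V_1^*, \mathbf W_2^*)$ is a global minimizer of $\mathcal{L}_{\mathrm{HVAE}}$ if and only if there are a singular value decomposition $\mathbf Z = \mathbf S \Theta \mathbf R^\top$ (with $\mathbf S \in \mathbb{R}^{D_0 \times D_0}$, $\mathbf R \in \mathbb{R}^{d_0 \times d_0}$ orthogonal and singular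 values $\theta_1 \ge \dots \ge \theta_{d_0} \ge 0$) and orthogonal matrices $\mathbf P \in \mathbb{R}^{d_1 \times d_1}$, $\mathbf Q \in \mathbb{R}^{d_2 \times d_2}$ such that $$\mathbf V_1^* = \mathbf P \Lambda \mathbf R^\top, \quad \mathbf U_2^* = \mathbf P \Omega \mathbf Q^\top, \quad \mathbf W_2^* = \mathbf U_2^{*\top}\Big(\mathbf U_2^* \mathbf U_2^{*\top} + \tfrac{\beta_2}{\beta_1} c^2 \mathbf I\Big)^{-1}, \quad \mathbf U_1^* = \mathbf Z \mathbf V_1^{*\top} (\mathbf V_1^* \mathbf V_1^{*\top} + \sigma_1^2 \mathbf I)^{-1},$$ where $\Lambda \in \mathbb{R}^{d_1 \times d_0}$ and $\Omega \in \mathbb{R}^{d_1 \times d_2}$ are (rectangular) diagonal with the following diagonal entries, $i = 1, \dots, d_1$. Let $\tau := \max\Big\{\sqrt{\sqrt{\beta_1\beta_2}\, c\, \sigma_1\sigma_2},\ \frac{\beta_2}{\sqrt{\beta_1}} \frac{c^2\sigma_2^2}{\sigma_1}\Big\}$. - If $\theta_i \ge \tau$: $$\lambda_i^* = \sqrt[3]{\frac{\sigma_1^2}{\sqrt{\beta_1\beta_2}\,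 c\, \sigma_2}} \sqrt{\sqrt[3]{\theta_i^4} - \sqrt[3]{\beta_1\beta_2 c^2\sigma_1^2\sigma_2^2}}, \qquad \omega_i^* = \sqrt[3]{\frac{\sqrt{\beta_2}\, c\, \sigma_1}{\beta_1\sigma_2^2}} \sqrt{\sqrt[3]{\theta_i^2} - \sqrt[3]{\frac{\beta_2^2 c^4\sigma_2^4}{\beta_1\sigma_1^2}}}.$$ - If $\theta_i < \tau$ and $\sqrt{\beta_1}\sigma_1 \ge \sqrt{\beta_2}\, c\, \sigma_2$: $$\lambda_i^* = 0, \qquad \omega_i^* = \sqrt{\sqrt{\frac{\beta_2}{\beta_1}} \frac{c\,\sigma_1}{\sigma_2} - \frac{\beta_2}{\beta_1} c^2}.$$ - If $\theta_i < \tau$ and $\sqrt{\beta_1}\sigma_1 < \sqrt{\beta_2}\, c\, \sigma_2$: $$\lambda_i^* = \sqrt{\max\Big(0, \frac{\sigma_1}{\sqrt{\beta_1}} (\theta_i - \sqrt{\beta_1}\sigma_1)\Big)}, \qquad \omega_i^* = 0.$$ -/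

import Mathlib

open scoped Matrix

noncomputable section

namespace MHVAE

/-- The rectangular diagonal `m × n` matrix whose `(j, j)` entry is `a j`. -/
def rectDiag (m n : ℕ) (a : Fin n → ℝ) : Matrix (Fin m) (Fin n) ℝ :=
  Matrix.of fun i j => if (i : ℕ) = (j : ℕ) then a j else 0

/-- The squared Frobenius norm of a real matrix. -/
def frobSq {m n : ℕ} (M : Matrix (Fin m) (Fin n) ℝ) : ℝ :=
  ∑ i, ∑ j, M i j ^ 2

/-- `Z = S Θ Rᵀ` is a (full) singular value decomposition of the `D₀ × d₀` matrix `Z` (for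
`d₀ ≤ D₀`), with left singular vectors `S`, right singular vectors `R` and singular values
`θ 0 ≥ θ 1 ≥ ⋯ ≥ 0`. -/
structure IsSVD {D₀ d₀ : ℕ} (Z : Matrix (Fin D₀) (Fin d₀) ℝ)
    (S : Matrix (Fin D₀) (Fin D₀) ℝ) (θ : Fin d₀ → ℝ) (R : Matrix (Fin d₀) (Fin d₀) ℝ) :
    Prop where
  left_mem : S ∈ Matrix.orthogonalGroup (Fin D₀) ℝ
  right_mem : R ∈ Matrix.orthogonalGroup (Fin d₀) ℝ
  nonneg : ∀ j, 0 ≤ θ j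
  antitone : Antitone θ
  eq : Z = S * rectDiag D₀ d₀ θ * Rᵀ

/-- The training objective of the linear two-latent Markovian hierarchical VAE with decoder
standard deviation `ηdec`, prior standard deviation `ηenc`, KL weights `β₁`, `β₂`, encoder
covariances `Σ₁ = S₁`, `Σ₂ = S₂`, and `c = ηdec / ηenc`. -/
def loss {D₀ d₀ d₁ d₂ : ℕ} (ηdec ηenc β₁ β₂ : ℝ) (Z : Matrix (Fin D₀) (Fin d₀) ℝ)
    (S₁ : Matrix (Fin d₁) (Fin d₁) ℝ) (S₂ : Matrix (Fin d₂) (Fin d₂) ℝ)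
    (U₁ : Matrix (Fin D₀) (Fin d₁) ℝ) (U₂ : Matrix (Fin d₁) (Fin d₂) ℝ)
    (V₁ : Matrix (Fin d₁) (Fin d₀) ℝ) (W₂ : Matrix (Fin d₂) (Fin d₁) ℝ) : ℝ :=
  1 / ηdec ^ 2 *
      (frobSq (U₁ * V₁ - Z)
        + β₁ * frobSq ((U₂ * W₂ - 1) * V₁)
        + (U₁ᵀ * U₁ * S₁).trace
        + β₁ * (U₂ᵀ * U₂ * S₂).trace
        + β₁ * ((U₂ * W₂ - 1)ᵀ * (U₂ * W₂ - 1) * S₁).trace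
        + β₂ * (ηdec / ηenc) ^ 2 * frobSq (W₂ * V₁)
        + β₂ * (ηdec / ηenc) ^ 2 * (W₂ᵀ * W₂ * S₁).trace
        + β₂ * (ηdec / ηenc) ^ 2 * S₂.trace)
    - β₁ * Real.log S₁.det - β₂ * Real.log S₂.det

/-- The threshold `max {√(√(β₁β₂) c σ₁ σ₂), (β₂/√β₁) (c²σ₂²/σ₁)}` separating the regimes. -/
def threshold (β₁ β₂ c σ₁ σ₂ : ℝ) : ℝ :=
  max (√(√(β₁ * β₂) * c * σ₁ * σ₂)) (β₂ / √β₁ * (c ^ 2 * σ₂ ^ 2 / σ₁))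

/-- The optimal singular value `λ*` of `V₁` belonging to the singular value `θ` of `Z`.
The cube roots are taken of nonnegative numbers. -/
def lamStar (β₁ β₂ c σ₁ σ₂ θ : ℝ) : ℝ :=
  if threshold β₁ β₂ c σ₁ σ₂ ≤ θ then
    (σ₁ ^ 2 / (√(β₁ * β₂) * c * σ₂)) ^ (1 / 3 : ℝ) *
      √((θ ^ 4) ^ (1 / 3 : ℝ) - (β₁ * β₂ * c ^ 2 * σ₁ ^ 2 * σ₂ ^ 2) ^ (1 / 3 : ℝ))
  else if √β₂ * c * σ₂ ≤ √β₁ * σ₁ then 0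
  else √(max 0 (σ₁ / √β₁ * (θ - √β₁ * σ₁)))

/-- The optimal singular value `ω*` of `U₂` belonging to the singular value `θ` of `Z`. -/
def omStar (β₁ β₂ c σ₁ σ₂ θ : ℝ) : ℝ :=
  if threshold β₁ β₂ c σ₁ σ₂ ≤ θ then
    (√β₂ * c * σ₁ / (β₁ * σ₂ ^ 2)) ^ (1 / 3 : ℝ) *
      √((θ ^ 2) ^ (1 / 3 : ℝ) - (β₂ ^ 2 * c ^ 4 * σ₂ ^ 4 / (β₁ * σ₁ ^ 2)) ^ (1 / 3 : ℝ))
  else if √β₂ * c * σ₂ ≤ √β₁ * σ₁ then √(√(β₂ / β₁) * (c * σ₁ / σ₂) - β₂ / β₁ * c ^ 2)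
  else 0

end MHVAE

end

noncomputable section

namespace MHVAE

/-! With scalar encoder variances the loss is, up to a positive factor and an additive constant,
`energy`, which is invariant under rotations of the first latent space. Rotate so that `V₁ V₁ᵀ` is
diagonal with entries `aᵢ`, and let `bᵢ` be the squared norms of the rows of `U₂`. Completing
squares in `U₁` and `W₂` leaves the constant `frobSq Z`, a sum of scalar functions `cell` of `(sᵢ,
aᵢ, bᵢ)`, where `sᵢ` is the energy of `Z` along the `i`-th direction of `V₁`, and a nonnegative
`excess` (`energy_diagonal_mul`). The excess vanishes when `U₁`, `W₂` are the ridge solutions and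
the rows of `U₂` are orthogonal, and only then.

In the variables `log (a + p)`, `log (b + k)` a cell is a sum of exponentials and a constant, hence
convex, so a point satisfying the first order conditions is its unique minimizer
(`IsStationary.cell_le`). The closed forms satisfy them (`isStationary_star`).

A cell is affine in `s`, and `sᵢ` averages the eigenvalues of `Zᵀ Z` with weights `Eᵢⱼ²`, where `E`
has orthonormal rows. Row sums 1, column sums at most 1 and the monotonicity of the optimal value in
the eigenvalue give the Ky Fan type bound `sum_cell_ge`, attained at the leading singular
directions.

For the converse, equality forces every direction with `aᵢ > 0` to be an eigenvector of `Zᵀ Z`. The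
directions with `aᵢ = 0` do not affect the loss, so they may be replaced by sorted eigenvectors;
exchange arguments show that the result is an ordered singular value decomposition
(`exists_sorted_eigenbasis`). -/

/-- The contribution to the objective of one latent direction, in which the squared singular
values of `V₁` and `U₂` are `a` and `b`, and `s` is the energy of the data in that direction. -/
def cell (p q k β s a b : ℝ) : ℝ :=
  β * k * (a + p) / (b + k) + β * q * b - s * (a / (a + p))

/-- The first order (Karush–Kuhn–Tucker) conditions for `cell` on the quadrant `a, b ≥ 0`. -/
structure IsStationary (p q k β s a b : ℝ) : Prop where
  a_nonneg : 0 ≤ a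
  b_nonneg : 0 ≤ b
  a_le : s * p * (b + k) ≤ β * k * (a + p) ^ 2
  a_eq : 0 < a → s * p * (b + k) = β * k * (a + p) ^ 2
  b_le : k * (a + p) ≤ q * (b + k) ^ 2
  b_eq : 0 < b → k * (a + p) = q * (b + k) ^ 2

/-! ### The two-variable problem for one latent direction. -/

section Scalar

variable {p q k β s a b a' b' : ℝ}

/-- AM-GM for three positive numbers with product 1, together with its equality case. The numerator
`n` is a quadratic in `η`: completing the square settles `ξ ≥ 1/3`, and for smaller `ξ` all its
terms are positive. -/
lemma three_le_one_div_add_div_add {ξ η : ℝ} (hξ : 0 < ξ) (hη : 0 < η) :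
    3 ≤ 1 / ξ + ξ / η + η ∧ (1 / ξ + ξ / η + η = 3 → ξ = 1 ∧ η = 1) := by
  set n := η + ξ ^ 2 + ξ * η ^ 2 - 3 * ξ * η with hn
  have key : 1 / ξ + ξ / η + η - 3 = n / (ξ * η) := by
    rw [hn]; field_simp
  have hsq : 4 * ξ * n = (2 * ξ * η - (3 * ξ - 1)) ^ 2 + (ξ - 1) ^ 2 * (4 * ξ - 1) := by
    rw [hn]; ring
  suffices 0 ≤ n ∧ (n = 0 → ξ = 1 ∧ η = 1) by
    refine ⟨?_, fun h => this.2 ?_⟩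
    · have : 0 ≤ n / (ξ * η) := div_nonneg this.1 (by positivity)
      linarith
    · have h0 : n / (ξ * η) = 0 := by linarith
      exact (div_eq_zero_iff.1 h0).resolve_right (by positivity)
  rcases lt_or_ge ξ (1 / 3) with h | h
  · have : 0 < n := by
      have h1 : 0 < η * (1 - 3 * ξ) := mul_pos hη (by linarith)
      have h2 : 0 < ξ ^ 2 := by positivity
      have h3 : 0 < ξ * η ^ 2 := by positivity
      rw [hn]; linarith
    exact ⟨this.le, fun h0 => absurd h0 this.ne'⟩
  · have h1 : 0 ≤ (ξ - 1) ^ 2 * (4 * ξ - 1) := mul_nonneg (sq_nonneg _) (by linarith)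
    have h2 := sq_nonneg (2 * ξ * η - (3 * ξ - 1))
    constructor
    · exact nonneg_of_mul_nonneg_right (by linarith) (by positivity : 0 < 4 * ξ)
    · intro h0
      rw [h0, mul_zero] at hsq
      have h3 : (ξ - 1) ^ 2 * (4 * ξ - 1) = 0 := by linarith
      have h4 : (ξ - 1) ^ 2 = 0 :=
        (mul_eq_zero.1 h3).resolve_right (by linarith)
      have h5 : ξ = 1 := by
        have := pow_eq_zero_iff two_ne_zero |>.1 h4
        linarith
      subst h5
      have h6 : (2 * 1 * η - (3 * 1 - 1)) ^ 2 = 0 := by linarith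
      have := pow_eq_zero_iff two_ne_zero |>.1 h6
      exact ⟨rfl, by linarith⟩

/-- With `x = a + p` and `y = b + k`, the cell is a combination of `1/x`, `x/y` and `y` plus a
constant. At the stationary point the three terms are `A ≤ A + u ≤ A + u + v`, where `u` and `v` are
the multipliers of the constraints `a ≥ 0` and `b ≥ 0`; AM-GM bounds the common part `A`, and
complementary slackness the rest. -/
lemma IsStationary.cell_le (hp : 0 < p) (hk : 0 < k) (hβ : 0 < β) (hs : 0 ≤ s)
    (h : IsStationary p q k β s a b) (ha' : 0 ≤ a') (hb' : 0 ≤ b') :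
    cell p q k β s a b ≤ cell p q k β s a' b' ∧
      (cell p q k β s a' b' ≤ cell p q k β s a b → a' = a ∧ b' = b) := by
  obtain ⟨ha, hb, h1, h2, h3, h4⟩ := h
  have hx : 0 < a + p := by linarith
  have hy : 0 < b + k := by linarith
  have hx' : 0 < a' + p := by linarith
  have hy' : 0 < b' + k := by linarith
  set ξ := (a' + p) / (a + p) with hξd
  set η := (b' + k) / (b + k) with hηd
  have hξ : 0 < ξ := by positivity
  have hη : 0 < η := by positivity
  set A := s * p / (a + p) with hA
  set u := β * k * (a + p) / (b + k) - A with hu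
  set v := β * q * (b + k) - β * k * (a + p) / (b + k) with hv
  have hA0 : 0 ≤ A := by positivity
  have hu0 : 0 ≤ u := by
    rw [hu, hA, sub_nonneg, div_le_div_iff₀ hx hy]; nlinarith
  have hv0 : 0 ≤ v := by
    rw [hv, sub_nonneg, div_le_iff₀ hy]; nlinarith
  have hu1 : 0 ≤ u * (ξ - 1) := by
    rcases ha.eq_or_lt with h0 | h0
    · refine mul_nonneg hu0 ?_
      rw [hξd, sub_nonneg, one_le_div hx]; linarith
    · have : u = 0 := by
        rw [hu, hA, sub_eq_zero, div_eq_div_iff hy.ne' hx.ne']; linarith [h2 h0]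
      simp [this]
  have hv1 : 0 ≤ v * (η - 1) := by
    rcases hb.eq_or_lt with h0 | h0
    · refine mul_nonneg hv0 ?_
      rw [hηd, sub_nonneg, one_le_div hy]; linarith
    · have : v = 0 := by
        rw [hv, sub_eq_zero, eq_div_iff hy.ne']; linear_combination (-β) * h4 h0
      simp [this]
  have key : cell p q k β s a' b' - cell p q k β s a b =
      A * (1 / ξ + ξ / η + η - 3) + u * (ξ - 1) / η + u * ((η - 1) ^ 2 / η)
        + v * (η - 1) := by
    rw [hv, hu, hA, hξd, hηd, cell, cell]
    field_simp
    ring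
  obtain ⟨am1, am2⟩ := three_le_one_div_add_div_add hξ hη
  have t1 : 0 ≤ A * (1 / ξ + ξ / η + η - 3) := mul_nonneg hA0 (by linarith)
  have t2 : 0 ≤ u * (ξ - 1) / η := by positivity
  have t3 : 0 ≤ u * ((η - 1) ^ 2 / η) := by positivity
  refine ⟨by linarith, fun hle => ?_⟩
  suffices ξ = 1 ∧ η = 1 by
    obtain ⟨e1, e2⟩ := this
    rw [hξd, div_eq_one_iff_eq hx.ne'] at e1
    rw [hηd, div_eq_one_iff_eq hy.ne'] at e2
    constructor <;> linarith
  -- If `A = 0`, AM-GM gives nothing, but then `u > 0` and the `u`-terms force equality.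
  rcases hA0.eq_or_lt with h0 | h0
  · have hupos : 0 < u := by rw [hu, ← h0, sub_zero]; positivity
    have e3 : u * ((η - 1) ^ 2 / η) = 0 := by linarith
    have e2 : u * (ξ - 1) / η = 0 := by linarith
    have : (η - 1) ^ 2 = 0 := by
      rcases mul_eq_zero.1 e3 with h | h
      · linarith
      · exact (div_eq_zero_iff.1 h).resolve_right hη.ne'
    have : η - 1 = 0 := by simpa using this
    have e4 := (div_eq_zero_iff.1 e2).resolve_right hη.ne'
    have := (mul_eq_zero.1 e4).resolve_left hupos.ne'
    constructor <;> linarith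
  · have e1 : A * (1 / ξ + ξ / η + η - 3) = 0 := by linarith
    have := (mul_eq_zero.1 e1).resolve_left h0.ne'
    exact am2 (by linarith)

/-- Stationarity with `a > 0` gives `s` proportional to `(a + p)² / (b + k)`, and `b + k` grows no
faster than the square root of `a + p`. This transfers an ordering of the squared singular values of
`V₁` to those of `Z`. -/
lemma IsStationary.le_of_le {s' : ℝ} (hp : 0 < p) (hq : 0 < q) (hk : 0 < k) (hβ : 0 < β)
    (h : IsStationary p q k β s a b) (h' : IsStationary p q k β s' a' b')
    (ha' : 0 < a') (haa : a' ≤ a) : s' ≤ s := by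
  have e := h.a_eq (ha'.trans_le haa)
  have e' := h'.a_eq ha'
  have hb := h.b_nonneg
  have hb' := h'.b_nonneg
  have hy : 0 < b + k := by linarith
  have hy' : 0 < b' + k := by linarith
  have hx' : 0 < a' + p := by linarith
  have hx : 0 < a + p := by linarith
  have main : (a' + p) ^ 2 * (b + k) ≤ (a + p) ^ 2 * (b' + k) := by
    rcases hb.eq_or_lt with h0 | h0
    · apply mul_le_mul <;> first | positivity | skip
      · gcongr
      · linarith
    · have e3 := h.b_eq h0
      have e4 := h'.b_le
      have : ((a' + p) ^ 2 * (b + k)) ^ 2 ≤ ((a + p) ^ 2 * (b' + k)) ^ 2 := by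
        have : q * ((a' + p) ^ 2 * (b + k)) ^ 2 ≤ q * ((a + p) ^ 2 * (b' + k)) ^ 2 := by
          calc q * ((a' + p) ^ 2 * (b + k)) ^ 2 = (a' + p) ^ 4 * (k * (a + p)) := by
                rw [e3]; ring
            _ = k * (a + p) * (a' + p) * (a' + p) ^ 3 := by ring
            _ ≤ k * (a + p) * (a' + p) * (a + p) ^ 3 := by gcongr
            _ = (a + p) ^ 4 * (k * (a' + p)) := by ring
            _ ≤ (a + p) ^ 4 * (q * (b' + k) ^ 2) := by gcongr
            _ = q * ((a + p) ^ 2 * (b' + k)) ^ 2 := by ring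
        exact le_of_mul_le_mul_left this hq
      exact (pow_le_pow_iff_left₀ (by positivity) (by positivity) two_ne_zero).1 this
  have h5 : s' * (p * (b + k) * (b' + k)) ≤ s * (p * (b + k) * (b' + k)) := by
    calc s' * (p * (b + k) * (b' + k)) = β * k * ((a' + p) ^ 2 * (b + k)) := by
          linear_combination (b + k) * e'
      _ ≤ β * k * ((a + p) ^ 2 * (b' + k)) := by gcongr
      _ = s * (p * (b + k) * (b' + k)) := by linear_combination -(b' + k) * e
  exact le_of_mul_le_mul_right h5 (by positivity)

/-- A direction that `V₁` ignores sees nothing of `Z`; this is the freedom to replace such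
directions. -/
lemma cell_zero (p q k β s s' b : ℝ) : cell p q k β s 0 b = cell p q k β s' 0 b := by
  simp [cell]

end Scalar

/-! ### Cube roots, and the closed forms as stationary points. -/

lemma eq_of_pow_three_eq {x y : ℝ} (hx : 0 ≤ x) (hy : 0 ≤ y) (h : x ^ 3 = y ^ 3) : x = y :=
  (pow_left_inj₀ hx hy three_ne_zero).1 h

lemma rpow_third_pow_three {x : ℝ} (hx : 0 ≤ x) : (x ^ (1 / 3 : ℝ)) ^ 3 = x := by
  rw [← Real.rpow_natCast, ← Real.rpow_mul hx]; norm_num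

/-- A term `ρ^(1/3) * √(X^(1/3) - Y^(1/3))`, squared and shifted by the root of `ρ² Y`, is the cube
root of `ρ² X`. -/
lemma sq_rpow_third_mul_sqrt {ρ X Y w : ℝ} (hρ : 0 ≤ ρ) (hX : 0 ≤ X) (hY : 0 ≤ Y) (hYX : Y ≤ X)
    (hw : 0 ≤ w) (h : ρ ^ 2 * Y = w ^ 3) :
    (((ρ ^ (1 / 3 : ℝ) * √(X ^ (1 / 3 : ℝ) - Y ^ (1 / 3 : ℝ))) ^ 2) + w) ^ 3 = ρ ^ 2 * X := by
  have h0 : Y ^ (1 / 3 : ℝ) ≤ X ^ (1 / 3 : ℝ) := Real.rpow_le_rpow hY hYX (by norm_num)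
  have e1 : (ρ ^ (1 / 3 : ℝ)) ^ 2 * Y ^ (1 / 3 : ℝ) = w := by
    refine eq_of_pow_three_eq (by positivity) hw ?_
    rw [mul_pow, rpow_third_pow_three hY, ← pow_mul, mul_comm 2 3, pow_mul,
      rpow_third_pow_three hρ, h]
  rw [mul_pow, Real.sq_sqrt (by linarith), mul_sub, e1, sub_add_cancel, mul_pow,
    rpow_third_pow_three hX, ← pow_mul, mul_comm 2 3, pow_mul, rpow_third_pow_three hρ]

lemma lamStar_nonneg {β₁ β₂ c σ₁ σ₂ : ℝ} (hc : 0 < c) (hσ₂ : 0 < σ₂) (θ : ℝ) :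
    0 ≤ lamStar β₁ β₂ c σ₁ σ₂ θ := by
  unfold lamStar
  split_ifs <;> positivity

lemma omStar_nonneg {β₁ β₂ c σ₁ σ₂ : ℝ} (hβ₁ : 0 < β₁) (hc : 0 < c) (hσ₁ : 0 < σ₁)
    (θ : ℝ) : 0 ≤ omStar β₁ β₂ c σ₁ σ₂ θ := by
  unfold omStar
  split_ifs <;> positivity

lemma threshold_sq_le_iff {r₁ r₂ c σ₁ σ₂ θ : ℝ} (hr₁ : 0 < r₁) (hr₂ : 0 < r₂) (hc : 0 < c)
    (hσ₁ : 0 < σ₁) (hσ₂ : 0 < σ₂) (hθ : 0 ≤ θ) :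
    threshold (r₁ ^ 2) (r₂ ^ 2) c σ₁ σ₂ ≤ θ ↔
      r₁ * r₂ * c * σ₁ * σ₂ ≤ θ ^ 2 ∧ r₂ ^ 2 * c ^ 2 * σ₂ ^ 2 ≤ θ * r₁ * σ₁ := by
  rw [threshold, max_le_iff, ← mul_pow, Real.sqrt_sq (by positivity), Real.sqrt_sq hr₁.le,
    Real.sqrt_le_left hθ, div_mul_div_comm, div_le_iff₀ (by positivity)]
  simp only [mul_assoc]

/-- The closed forms for `λ*` and `ω*` solve the first order conditions. -/
lemma isStationary_star {β₁ β₂ c σ₁ σ₂ θ : ℝ} (hβ₁ : 0 < β₁) (hβ₂ : 0 < β₂) (hc : 0 < c)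
    (hσ₁ : 0 < σ₁) (hσ₂ : 0 < σ₂) (hθ : 0 ≤ θ) :
    IsStationary (σ₁ ^ 2) (σ₂ ^ 2) (β₂ / β₁ * c ^ 2) β₁ (θ ^ 2)
      (lamStar β₁ β₂ c σ₁ σ₂ θ ^ 2) (omStar β₁ β₂ c σ₁ σ₂ θ ^ 2) := by
  -- Writing `β₁`, `β₂` as squares removes the square roots from the formulas.
  obtain ⟨r₁, hr₁, rfl⟩ : ∃ r, 0 < r ∧ β₁ = r ^ 2 :=
    ⟨√β₁, Real.sqrt_pos.2 hβ₁, (Real.sq_sqrt hβ₁.le).symm⟩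
  obtain ⟨r₂, hr₂, rfl⟩ : ∃ r, 0 < r ∧ β₂ = r ^ 2 :=
    ⟨√β₂, Real.sqrt_pos.2 hβ₂, (Real.sq_sqrt hβ₂.le).symm⟩
  have s1 : √(r₁ ^ 2) = r₁ := Real.sqrt_sq hr₁.le
  have s2 : √(r₂ ^ 2) = r₂ := Real.sqrt_sq hr₂.le
  have s3 : √(r₁ ^ 2 * r₂ ^ 2) = r₁ * r₂ := by rw [← mul_pow, Real.sqrt_sq (by positivity)]
  have s4 : √(r₂ ^ 2 / r₁ ^ 2) = r₂ / r₁ := by rw [← div_pow, Real.sqrt_sq (by positivity)]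
  simp only [lamStar, omStar, threshold_sq_le_iff hr₁ hr₂ hc hσ₁ hσ₂ hθ, s1, s2, s3, s4]
  by_cases hreg : r₁ * r₂ * c * σ₁ * σ₂ ≤ θ ^ 2 ∧ r₂ ^ 2 * c ^ 2 * σ₂ ^ 2 ≤ θ * r₁ * σ₁
  · rw [if_pos hreg, if_pos hreg]
    obtain ⟨hA, hB⟩ := hreg
    have ea := sq_rpow_third_mul_sqrt (ρ := σ₁ ^ 2 / (r₁ * r₂ * c * σ₂)) (X := θ ^ 4)
      (Y := r₁ ^ 2 * r₂ ^ 2 * c ^ 2 * σ₁ ^ 2 * σ₂ ^ 2) (w := σ₁ ^ 2) (by positivity)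
      (by positivity) (by positivity)
      (by calc r₁ ^ 2 * r₂ ^ 2 * c ^ 2 * σ₁ ^ 2 * σ₂ ^ 2 = (r₁ * r₂ * c * σ₁ * σ₂) ^ 2 := by ring
            _ ≤ (θ ^ 2) ^ 2 := by gcongr
            _ = θ ^ 4 := by ring) (by positivity) (by field_simp)
    have eb := sq_rpow_third_mul_sqrt (ρ := r₂ * c * σ₁ / (r₁ ^ 2 * σ₂ ^ 2)) (X := θ ^ 2)
      (Y := (r₂ ^ 2) ^ 2 * c ^ 4 * σ₂ ^ 4 / (r₁ ^ 2 * σ₁ ^ 2)) (w := r₂ ^ 2 / r₁ ^ 2 * c ^ 2)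
      (by positivity) (by positivity) (by positivity)
      (by rw [div_le_iff₀ (by positivity)]
          calc (r₂ ^ 2) ^ 2 * c ^ 4 * σ₂ ^ 4 = (r₂ ^ 2 * c ^ 2 * σ₂ ^ 2) ^ 2 := by ring
            _ ≤ (θ * r₁ * σ₁) ^ 2 := by gcongr
            _ = θ ^ 2 * (r₁ ^ 2 * σ₁ ^ 2) := by ring) (by positivity) (by field_simp)
    set a := ((σ₁ ^ 2 / (r₁ * r₂ * c * σ₂)) ^ (1 / 3 : ℝ) *
      √((θ ^ 4) ^ (1 / 3 : ℝ) - (r₁ ^ 2 * r₂ ^ 2 * c ^ 2 * σ₁ ^ 2 * σ₂ ^ 2) ^ (1 / 3 : ℝ))) ^ 2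
    set b := ((r₂ * c * σ₁ / (r₁ ^ 2 * σ₂ ^ 2)) ^ (1 / 3 : ℝ) *
      √((θ ^ 2) ^ (1 / 3 : ℝ) -
        ((r₂ ^ 2) ^ 2 * c ^ 4 * σ₂ ^ 4 / (r₁ ^ 2 * σ₁ ^ 2)) ^ (1 / 3 : ℝ))) ^ 2
    have ha : 0 ≤ a := sq_nonneg _
    have hb : 0 ≤ b := sq_nonneg _
    -- The cubes of `a + p` and `b + k` are rational in the data by `ea` and `eb`, so both equations
    -- are checked after cubing.
    have h1 : θ ^ 2 * σ₁ ^ 2 * (b + r₂ ^ 2 / r₁ ^ 2 * c ^ 2) =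
        r₁ ^ 2 * (r₂ ^ 2 / r₁ ^ 2 * c ^ 2) * (a + σ₁ ^ 2) ^ 2 := by
      refine eq_of_pow_three_eq (by positivity) (by positivity) ?_
      calc (θ ^ 2 * σ₁ ^ 2 * (b + r₂ ^ 2 / r₁ ^ 2 * c ^ 2)) ^ 3
          = θ ^ 6 * σ₁ ^ 6 * (b + r₂ ^ 2 / r₁ ^ 2 * c ^ 2) ^ 3 := by ring
        _ = (r₁ ^ 2 * (r₂ ^ 2 / r₁ ^ 2 * c ^ 2)) ^ 3 * ((a + σ₁ ^ 2) ^ 3) ^ 2 := by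
            rw [ea, eb]; field_simp
        _ = _ := by ring
    have h2 : r₂ ^ 2 / r₁ ^ 2 * c ^ 2 * (a + σ₁ ^ 2) =
        σ₂ ^ 2 * (b + r₂ ^ 2 / r₁ ^ 2 * c ^ 2) ^ 2 := by
      refine eq_of_pow_three_eq (by positivity) (by positivity) ?_
      calc (r₂ ^ 2 / r₁ ^ 2 * c ^ 2 * (a + σ₁ ^ 2)) ^ 3
          = (r₂ ^ 2 / r₁ ^ 2 * c ^ 2) ^ 3 * (a + σ₁ ^ 2) ^ 3 := by ring
        _ = σ₂ ^ 6 * ((b + r₂ ^ 2 / r₁ ^ 2 * c ^ 2) ^ 3) ^ 2 := by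
            rw [ea, eb]; field_simp
        _ = _ := by ring
    exact ⟨ha, hb, h1.le, fun _ => h1, h2.le, fun _ => h2⟩
  · rw [if_neg hreg, if_neg hreg]
    by_cases hcmp : r₂ * c * σ₂ ≤ r₁ * σ₁
    · rw [if_pos hcmp, if_pos hcmp]
      -- In this regime the first term of the threshold dominates, so its bound implies the other
      -- one and must fail.
      have hA : θ ^ 2 ≤ r₁ * r₂ * c * σ₁ * σ₂ := by
        by_contra! hA
        refine hreg ⟨hA.le, ?_⟩
        refine (pow_le_pow_iff_left₀ (by positivity) (by positivity) two_ne_zero).1 ?_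
        calc (r₂ ^ 2 * c ^ 2 * σ₂ ^ 2) ^ 2 = (r₂ * c * σ₂) ^ 3 * (r₂ * c * σ₂) := by ring
          _ ≤ (r₁ * σ₁) ^ 3 * (r₂ * c * σ₂) := by gcongr
          _ = (r₁ * r₂ * c * σ₁ * σ₂) * (r₁ * σ₁) ^ 2 := by ring
          _ ≤ θ ^ 2 * (r₁ * σ₁) ^ 2 := by gcongr
          _ = _ := by ring
      have hy : 0 ≤ r₂ / r₁ * (c * σ₁ / σ₂) - r₂ ^ 2 / r₁ ^ 2 * c ^ 2 := by
        have : r₂ / r₁ * (c * σ₁ / σ₂) - r₂ ^ 2 / r₁ ^ 2 * c ^ 2 =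
            r₂ * c / (r₁ ^ 2 * σ₂) * (r₁ * σ₁ - r₂ * c * σ₂) := by field_simp
        rw [this]
        exact mul_nonneg (by positivity) (by linarith)
      rw [Real.sq_sqrt hy, zero_pow two_ne_zero]
      have h2 : r₂ ^ 2 / r₁ ^ 2 * c ^ 2 * (0 + σ₁ ^ 2) = σ₂ ^ 2 *
          (r₂ / r₁ * (c * σ₁ / σ₂) - r₂ ^ 2 / r₁ ^ 2 * c ^ 2 + r₂ ^ 2 / r₁ ^ 2 * c ^ 2) ^ 2 := by
        rw [sub_add_cancel]; field_simp; ring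
      refine ⟨le_rfl, hy, ?_, fun h => absurd h (lt_irrefl _), h2.le, fun _ => h2⟩
      rw [sub_add_cancel]
      calc θ ^ 2 * σ₁ ^ 2 * (r₂ / r₁ * (c * σ₁ / σ₂))
          ≤ r₁ * r₂ * c * σ₁ * σ₂ * σ₁ ^ 2 * (r₂ / r₁ * (c * σ₁ / σ₂)) := by gcongr
        _ = _ := by field_simp; ring
    · rw [if_neg hcmp, if_neg hcmp]
      push Not at hcmp
      -- Here the second term of the threshold dominates.
      have hB : θ * r₁ * σ₁ ≤ r₂ ^ 2 * c ^ 2 * σ₂ ^ 2 := by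
        by_contra! hB
        refine hreg ⟨?_, hB.le⟩
        have : (r₁ * r₂ * c * σ₁ * σ₂) * (r₁ * σ₁) ^ 2 ≤ θ ^ 2 * (r₁ * σ₁) ^ 2 := by
          calc (r₁ * r₂ * c * σ₁ * σ₂) * (r₁ * σ₁) ^ 2 = (r₁ * σ₁) ^ 3 * (r₂ * c * σ₂) := by ring
            _ ≤ (r₂ * c * σ₂) ^ 3 * (r₂ * c * σ₂) := by gcongr
            _ = (r₂ ^ 2 * c ^ 2 * σ₂ ^ 2) ^ 2 := by ring
            _ ≤ (θ * r₁ * σ₁) ^ 2 := by gcongr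
            _ = _ := by ring
        exact le_of_mul_le_mul_right this (by positivity)
      rw [Real.sq_sqrt (le_max_left _ _), zero_pow two_ne_zero]
      have e1 : σ₁ / r₁ * (θ - r₁ * σ₁) + σ₁ ^ 2 = σ₁ * θ / r₁ := by field_simp; ring
      have e2 : r₁ ^ 2 * (r₂ ^ 2 / r₁ ^ 2 * c ^ 2) = r₂ ^ 2 * c ^ 2 := by field_simp
      have hx : max 0 (σ₁ / r₁ * (θ - r₁ * σ₁)) + σ₁ ^ 2 = max (σ₁ ^ 2) (σ₁ * θ / r₁) := by
        rw [max_add, zero_add, e1]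
      have eqn : θ ^ 2 * σ₁ ^ 2 * (r₂ ^ 2 / r₁ ^ 2 * c ^ 2) =
          r₂ ^ 2 * c ^ 2 * (σ₁ * θ / r₁) ^ 2 := by field_simp
      refine ⟨le_max_left _ _, le_rfl, ?_, fun h => ?_, ?_, fun h => absurd h (lt_irrefl _)⟩
      · rw [hx, zero_add, eqn, e2]
        have := le_max_right (σ₁ ^ 2) (σ₁ * θ / r₁)
        gcongr
      · have h' : 0 < σ₁ / r₁ * (θ - r₁ * σ₁) := (lt_max_iff.1 h).resolve_left (lt_irrefl _)
        rw [max_eq_right h'.le, e1, zero_add, eqn, e2]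
      · rw [hx, zero_add]
        have hx2 : max (σ₁ ^ 2) (σ₁ * θ / r₁) ≤ σ₂ ^ 2 * (r₂ ^ 2 / r₁ ^ 2 * c ^ 2) := by
          refine max_le ?_ ?_
          · have : σ₁ ^ 2 * r₁ ^ 2 ≤ σ₂ ^ 2 * (r₂ ^ 2 * c ^ 2) := by
              calc σ₁ ^ 2 * r₁ ^ 2 = (r₁ * σ₁) ^ 2 := by ring
                _ ≤ (r₂ * c * σ₂) ^ 2 := by gcongr
                _ = _ := by ring
            calc σ₁ ^ 2 ≤ σ₂ ^ 2 * (r₂ ^ 2 * c ^ 2) / r₁ ^ 2 := by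
                  rwa [le_div_iff₀ (by positivity)]
              _ = _ := by ring
          · rw [div_le_iff₀ hr₁]
            calc σ₁ * θ = θ * r₁ * σ₁ / r₁ := by field_simp
              _ ≤ r₂ ^ 2 * c ^ 2 * σ₂ ^ 2 / r₁ := by gcongr
              _ = _ := by field_simp
        calc r₂ ^ 2 / r₁ ^ 2 * c ^ 2 * max (σ₁ ^ 2) (σ₁ * θ / r₁)
            ≤ r₂ ^ 2 / r₁ ^ 2 * c ^ 2 * (σ₂ ^ 2 * (r₂ ^ 2 / r₁ ^ 2 * c ^ 2)) := by gcongr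
          _ = _ := by ring

/-! ### Orthogonal completion, diagonalization and singular value decompositions. -/

/-- The first `m` rows of a matrix. -/
def topRows {m n l : ℕ} (h : m ≤ n) (M : Matrix (Fin n) (Fin l) ℝ) : Matrix (Fin m) (Fin l) ℝ :=
  M.submatrix (Fin.castLE h) id

lemma topRows_apply {m n l : ℕ} (h : m ≤ n) (M : Matrix (Fin n) (Fin l) ℝ) (i : Fin m)
    (j : Fin l) : topRows h M i j = M (Fin.castLE h i) j := rfl

lemma rectDiag_mul {m n l : ℕ} (h : m ≤ n) (f : Fin n → ℝ) (M : Matrix (Fin n) (Fin l) ℝ) :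
    rectDiag m n f * M = Matrix.diagonal (fun i => f (Fin.castLE h i)) * topRows h M := by
  ext i j
  rw [Matrix.diagonal_mul, Matrix.mul_apply, Finset.sum_eq_single (Fin.castLE h i)]
  · simp [rectDiag, topRows]
  · intro k _ hk
    have : (i : ℕ) ≠ k := fun e => hk (Fin.ext (by simp [e]))
    simp [rectDiag, this]
  · simp

lemma rectDiag_self (n : ℕ) (f : Fin n → ℝ) : rectDiag n n f = Matrix.diagonal f := by
  simpa [topRows] using rectDiag_mul le_rfl f (1 : Matrix (Fin n) (Fin n) ℝ)

lemma rectDiag_transpose_mul_rectDiag {m n : ℕ} (h : n ≤ m) (f : Fin n → ℝ) :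
    (rectDiag m n f)ᵀ * rectDiag m n f = Matrix.diagonal (fun i => f i ^ 2) := by
  ext i j
  rw [Matrix.mul_apply, Finset.sum_eq_single (Fin.castLE h i)]
  · by_cases hij : i = j
    · simp [rectDiag, hij, sq]
    · have : (i : ℕ) ≠ j := fun e => hij (Fin.ext e)
      simp [rectDiag, hij, this]
  · intro k _ hk
    have : (k : ℕ) ≠ i := fun e => hk (Fin.ext (by simp [e]))
    simp [rectDiag, this]
  · simp

lemma topRows_mul_transpose {m n : ℕ} (h : m ≤ n) {O : Matrix (Fin n) (Fin n) ℝ}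
    (hO : O ∈ Matrix.orthogonalGroup (Fin n) ℝ) : topRows h Oᵀ * (topRows h Oᵀ)ᵀ = 1 := by
  have : Oᵀ * O = 1 := (Matrix.mem_orthogonalGroup_iff' _ _).1 hO
  ext i j
  have h' := congrFun₂ this (Fin.castLE h i) (Fin.castLE h j)
  simp only [Matrix.mul_apply, Matrix.transpose_apply, topRows_apply] at h' ⊢
  rw [h', Matrix.one_apply, Matrix.one_apply]
  simp [Fin.ext_iff]

lemma orthonormalBasis_mem_orthogonalGroup {n : ℕ}
    (b : OrthonormalBasis (Fin n) ℝ (EuclideanSpace ℝ (Fin n))) :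
    (Matrix.of fun k j => b j k) ∈ Matrix.orthogonalGroup (Fin n) ℝ := by
  rw [Matrix.mem_orthogonalGroup_iff']
  ext i j
  have := orthonormal_iff_ite.1 b.orthonormal i j
  rw [PiLp.inner_apply] at this
  simp only [Matrix.mul_apply, Matrix.of_apply, Matrix.one_apply]
  rw [← this]
  simp [mul_comm]

lemma orthonormal_col {n : ℕ} {O : Matrix (Fin n) (Fin n) ℝ}
    (hO : O ∈ Matrix.orthogonalGroup (Fin n) ℝ) :
    Orthonormal ℝ (fun j => (WithLp.toLp 2 (fun k => O k j) : EuclideanSpace ℝ (Fin n))) := by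
  have : Oᵀ * O = 1 := (Matrix.mem_orthogonalGroup_iff' _ _).1 hO
  rw [orthonormal_iff_ite]
  intro i j
  have h' := congrFun₂ this i j
  rw [Matrix.one_apply, Matrix.mul_apply] at h'
  rw [← h', PiLp.inner_apply]
  simp [mul_comm]

/-- A matrix with pairwise orthogonal rows factors through a matrix with orthonormal rows, which
extends to an orthogonal matrix. -/
lemma exists_orthogonal_of_mul_transpose_eq_diagonal {m n : ℕ} (h : m ≤ n)
    (M : Matrix (Fin m) (Fin n) ℝ) (a : Fin m → ℝ)
    (hM : M * Mᵀ = Matrix.diagonal (fun i => a i ^ 2)) :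
    ∃ O ∈ Matrix.orthogonalGroup (Fin n) ℝ, M = Matrix.diagonal a * topRows h Oᵀ := by
  classical
  have hrow (i j : Fin m) : ∑ k, M i k * M j k = if i = j then a i ^ 2 else 0 := by
    simpa [Matrix.mul_apply, Matrix.diagonal_apply] using congrFun₂ hM i j
  -- Only indices in `s` matter; the zero padding and the quotients by `a = 0` are never used.
  let v : Fin n → EuclideanSpace ℝ (Fin n) := fun j =>
    if hj : (j : ℕ) < m then WithLp.toLp 2 (fun k => M ⟨j, hj⟩ k / a ⟨j, hj⟩) else 0
  let s : Set (Fin n) := {j | ∃ hj : (j : ℕ) < m, a ⟨j, hj⟩ ≠ 0}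
  have hv : Orthonormal ℝ (s.domRestrict v) := by
    rw [orthonormal_iff_ite]
    rintro ⟨i, hi, hai⟩ ⟨j, hj, haj⟩
    have e : inner ℝ (v i) (v j) = (∑ k, M ⟨i, hi⟩ k * M ⟨j, hj⟩ k) / (a ⟨i, hi⟩ * a ⟨j, hj⟩) := by
      simp only [v, hi, hj, dif_pos, PiLp.inner_apply, Finset.sum_div]
      refine Finset.sum_congr rfl fun k _ => ?_
      simp only [RCLike.inner_apply, conj_trivial]
      ring
    change inner ℝ (v i) (v j) = _
    rw [e, hrow]
    by_cases hij : i = j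
    · subst hij
      simp only [if_true]
      field_simp
    · have : (i : ℕ) ≠ j := fun e => hij (Fin.ext e)
      simp [hij, this]
  obtain ⟨b, hb⟩ := hv.exists_orthonormalBasis_extension_of_card_eq (by simp)
  refine ⟨_, orthonormalBasis_mem_orthogonalGroup b, ?_⟩
  ext i k
  rw [Matrix.diagonal_mul]
  simp only [topRows_apply, Matrix.transpose_apply, Matrix.of_apply]
  by_cases ha : a i = 0
  · have := hrow i i
    rw [if_pos rfl, ha, zero_pow two_ne_zero,
      Finset.sum_eq_zero_iff_of_nonneg (fun _ _ => mul_self_nonneg _)] at this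
    simpa [ha] using this k (Finset.mem_univ k)
  · rw [hb (Fin.castLE h i) ⟨i.2, ha⟩]
    simp only [v, Fin.val_castLE, i.2, dif_pos]
    field_simp

/-- Orthonormal eigenvectors of a symmetric operator extend to an eigenbasis, whose new eigenvalues
are sorted. -/
lemma exists_eigenbasis_extension {E : Type*} [NormedAddCommGroup E] [InnerProductSpace ℝ E]
    [FiniteDimensional ℝ E] {T : E →ₗ[ℝ] E} (hT : T.IsSymmetric) {m k : ℕ}
    (hn : Module.finrank ℝ E = m + k) {r : Fin m → E} (hr : Orthonormal ℝ r) {ν : Fin m → ℝ}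
    (hν : ∀ i, T (r i) = ν i • r i) :
    ∃ (f : OrthonormalBasis (Fin (m + k)) ℝ E) (μ : Fin (m + k) → ℝ),
      (∀ j, T (f j) = μ j • f j) ∧ (∀ i, f (Fin.castAdd k i) = r i) ∧
      ∀ j l : Fin (m + k), m ≤ (j : ℕ) → j ≤ l → μ l ≤ μ j := by
  set K := (Submodule.span ℝ (Set.range r))ᗮ with hK
  have hmem (v : E) : v ∈ K ↔ ∀ i, inner ℝ (r i) v = 0 := by
    rw [hK, Submodule.mem_orthogonal]
    constructor
    · exact fun h i => h _ (Submodule.subset_span ⟨i, rfl⟩)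
    · intro h u hu
      induction hu using Submodule.span_induction with
      | mem x hx => obtain ⟨i, rfl⟩ := hx; exact h i
      | zero => simp
      | add x y _ _ hx hy => rw [inner_add_left, hx, hy, add_zero]
      | smul c x _ hx => rw [inner_smul_left, hx, mul_zero]
  -- A symmetric operator preserves the complement of a span of eigenvectors, so the spectral
  -- theorem applies there.
  have hinv : ∀ v ∈ K, T v ∈ K := by
    intro v hv
    rw [hmem] at hv ⊢
    intro i
    rw [← hT, hν, inner_smul_left, hv, mul_zero]
  have hfr : Module.finrank ℝ K = k := by
    have h1 := Submodule.finrank_add_finrank_orthogonal (Submodule.span ℝ (Set.range r))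
    rw [finrank_span_eq_card hr.linearIndependent, Fintype.card_fin, hn] at h1
    exact Nat.add_left_cancel h1
  have hTK := hT.restrict_invariant hinv
  let e := hTK.eigenvectorBasis hfr
  let g : Fin (m + k) → E := Fin.append r (fun l => (e l : E))
  have hg : Orthonormal ℝ g := by
    have horth (i : Fin m) (l : Fin k) : inner ℝ (r i) (e l : E) = 0 := (hmem _).1 (e l).2 i
    rw [orthonormal_iff_ite]
    intro i j
    have hr' := orthonormal_iff_ite.1 hr
    have he' := orthonormal_iff_ite.1 e.orthonormal
    induction i using Fin.addCases with
    | left i =>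
      induction j using Fin.addCases with
      | left j => simp [g, hr']
      | right j =>
        have : Fin.castAdd k i ≠ Fin.natAdd m j := fun h => by
          have := congrArg Fin.val h
          simp at this
          omega
        simp [g, horth, this]
    | right i =>
      induction j using Fin.addCases with
      | left j =>
        have : Fin.natAdd m i ≠ Fin.castAdd k j := fun h => by
          have := congrArg Fin.val h
          simp at this
          omega
        rw [real_inner_comm]
        simp [g, horth, this]
      | right j =>
        have := he' i j
        rw [Submodule.coe_inner] at this
        simp [g, this]
  obtain ⟨f, hf⟩ := Orthonormal.exists_orthonormalBasis_extension_of_card_eq (𝕜 := ℝ) (v := g)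
    (s := Set.univ) (by simp [hn]) (hg.comp _ Subtype.val_injective)
  have hfg (j) : f j = g j := hf j (Set.mem_univ j)
  refine ⟨f, Fin.append ν (hTK.eigenvalues hfr), fun j => ?_, fun i => ?_, fun j l hj hjl => ?_⟩
  · rw [hfg]
    induction j using Fin.addCases with
    | left i => simp [g, hν]
    | right i =>
      have := congrArg Subtype.val (hTK.apply_eigenvectorBasis hfr i)
      simpa only [g, Fin.append_right, LinearMap.coe_restrict_apply, Submodule.coe_smul,
        RCLike.ofReal_real_eq_id, id_eq] using this
  · simp [hfg, g]
  · obtain ⟨j', rfl⟩ : ∃ j', j = Fin.natAdd m j' :=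
      ⟨⟨j - m, by omega⟩, Fin.ext (by simp; omega)⟩
    have hl : m ≤ (l : ℕ) := hj.trans hjl
    obtain ⟨l', rfl⟩ : ∃ l', l = Fin.natAdd m l' :=
      ⟨⟨l - m, by omega⟩, Fin.ext (by simp; omega)⟩
    simp only [Fin.append_right]
    exact hTK.eigenvalues_antitone hfr (by simpa using hjl)

/-- Columns of `O` that are already eigenvectors survive, and only their complement is diagonalized
anew. The new eigenvalues are sorted among themselves; comparing them with the kept ones needs
optimality. For `m = 0` this is the spectral theorem. -/
lemma exists_orthogonal_diagonalization_extension {n m : ℕ} (hm : m ≤ n)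
    {H O : Matrix (Fin n) (Fin n) ℝ} (hH : Hᵀ = H) (hO : O ∈ Matrix.orthogonalGroup (Fin n) ℝ)
    {ν : Fin n → ℝ} (hν : ∀ i : Fin n, (i : ℕ) < m → ∀ k, (H * O) k i = ν i * O k i) :
    ∃ R ∈ Matrix.orthogonalGroup (Fin n) ℝ, ∃ μ : Fin n → ℝ, H * R = R * Matrix.diagonal μ ∧
      (∀ i : Fin n, (i : ℕ) < m → ∀ k, R k i = O k i) ∧
      ∀ j l : Fin n, m ≤ (j : ℕ) → j ≤ l → μ l ≤ μ j := by
  obtain ⟨k, rfl⟩ := Nat.exists_eq_add_of_le hm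
  have hT : (Matrix.toEuclideanLin H).IsSymmetric := by
    rw [Matrix.isSymmetric_toEuclideanLin_iff, Matrix.IsHermitian,
      Matrix.conjTranspose_eq_transpose_of_trivial]
    exact hH
  obtain ⟨f, μ, h1, h2, h3⟩ := exists_eigenbasis_extension hT (m := m) (k := k) (by simp)
    (r := fun i => WithLp.toLp 2 (fun l => O l (Fin.castAdd k i)))
    ((orthonormal_col hO).comp _ (Fin.castAdd_injective m k))
    (ν := fun i => ν (Fin.castAdd k i)) (by
      intro i
      ext l
      have := hν (Fin.castAdd k i) (by simp) l
      simpa [Matrix.toLpLin_apply, Matrix.mulVec, dotProduct, Matrix.mul_apply] using this)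
  refine ⟨_, orthonormalBasis_mem_orthogonalGroup f, μ, ?_, ?_, h3⟩
  · ext l j
    have := congrArg (fun v => v l) (h1 j)
    rw [Matrix.mul_diagonal]
    simpa [Matrix.toLpLin_apply, Matrix.mulVec, dotProduct, Matrix.mul_apply, mul_comm] using this
  · intro i hi l
    obtain ⟨i', rfl⟩ : ∃ i', i = Fin.castAdd k i' := ⟨⟨i, hi⟩, Fin.ext (by simp)⟩
    simp [h2]

lemma exists_orthogonal_diagonalization {n : ℕ} {H : Matrix (Fin n) (Fin n) ℝ} (hH : Hᵀ = H) :
    ∃ R ∈ Matrix.orthogonalGroup (Fin n) ℝ, ∃ μ : Fin n → ℝ, H * R = R * Matrix.diagonal μ ∧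
      Antitone μ := by
  obtain ⟨R, hR, μ, h1, -, h3⟩ := exists_orthogonal_diagonalization_extension (m := 0)
    (Nat.zero_le n) hH (one_mem _) (ν := 0) (by simp)
  exact ⟨R, hR, μ, h1, fun j l => h3 j l (Nat.zero_le _)⟩

lemma transpose_mul_self_mul_mul {m n : ℕ} {M : Matrix (Fin m) (Fin n) ℝ}
    {R : Matrix (Fin n) (Fin n) ℝ} (hR : R ∈ Matrix.orthogonalGroup (Fin n) ℝ) {μ : Fin n → ℝ}
    (h : Mᵀ * M * R = R * Matrix.diagonal μ) : (M * R)ᵀ * (M * R) = Matrix.diagonal μ := by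
  have : Rᵀ * R = 1 := (Matrix.mem_orthogonalGroup_iff' _ _).1 hR
  rw [Matrix.transpose_mul, Matrix.mul_assoc, ← Matrix.mul_assoc Mᵀ, h, ← Matrix.mul_assoc, this,
    Matrix.one_mul]

lemma nonneg_of_transpose_mul_self_eq_diagonal {m n : ℕ} {M : Matrix (Fin m) (Fin n) ℝ}
    {μ : Fin n → ℝ} (h : Mᵀ * M = Matrix.diagonal μ) (i : Fin n) : 0 ≤ μ i := by
  have := congrFun₂ h i i
  rw [Matrix.diagonal_apply_eq, Matrix.mul_apply] at this
  rw [← this]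
  exact Finset.sum_nonneg fun k _ => mul_self_nonneg (M k i)

/-- A sorted eigenbasis of `Zᵀ Z` gives a singular value decomposition of `Z`. -/
lemma exists_isSVD_of_eigenbasis {m n : ℕ} (h : n ≤ m) {Z : Matrix (Fin m) (Fin n) ℝ}
    {R : Matrix (Fin n) (Fin n) ℝ} (hR : R ∈ Matrix.orthogonalGroup (Fin n) ℝ) {μ : Fin n → ℝ}
    (hμ : Antitone μ) (hZ : Zᵀ * Z * R = R * Matrix.diagonal μ) :
    ∃ S, IsSVD Z S (fun i => √(μ i)) R := by
  have h1 := transpose_mul_self_mul_mul hR hZ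
  have h0 := nonneg_of_transpose_mul_self_eq_diagonal h1
  obtain ⟨S, hS, hM⟩ := exists_orthogonal_of_mul_transpose_eq_diagonal h (Z * R)ᵀ
    (fun i => √(μ i)) (by simpa [Real.sq_sqrt (h0 _)] using h1)
  refine ⟨S, hS, hR, fun _ => Real.sqrt_nonneg _, fun i j hij => Real.sqrt_le_sqrt (hμ hij), ?_⟩
  -- The entries of `rectDiag` are indexed by columns, so the transpose needs `θ` extended to `m`
  -- indices; the padding value never appears in it.
  have e : (rectDiag m n fun i => √(μ i))ᵀ = rectDiag n m (fun j => if hj : (j : ℕ) < n then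
      √(μ ⟨j, hj⟩) else 0) := by
    ext i j
    by_cases hij : (i : ℕ) = j
    · have hj : (j : ℕ) < n := hij ▸ i.2
      have : i = ⟨j, hj⟩ := Fin.ext hij
      simp [rectDiag, this, hj.not_ge]
    · simp [rectDiag, hij, Ne.symm hij]
  have hZR : Z * R = S * rectDiag m n fun i => √(μ i) := by
    rw [← Matrix.transpose_inj, hM, Matrix.transpose_mul, e, rectDiag_mul h]
    simp
  rw [← hZR, Matrix.mul_assoc, show R * Rᵀ = 1 from (Matrix.mem_orthogonalGroup_iff _ _).1 hR,
    Matrix.mul_one]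

lemma IsSVD.transpose_mul_self_mul {m n : ℕ} (h : n ≤ m) {Z : Matrix (Fin m) (Fin n) ℝ}
    {S : Matrix (Fin m) (Fin m) ℝ} {θ : Fin n → ℝ} {R : Matrix (Fin n) (Fin n) ℝ}
    (hZ : IsSVD Z S θ R) : Zᵀ * Z * R = R * Matrix.diagonal (fun i => θ i ^ 2) := by
  have hS : Sᵀ * S = 1 := (Matrix.mem_orthogonalGroup_iff' _ _).1 hZ.left_mem
  have hR : Rᵀ * R = 1 := (Matrix.mem_orthogonalGroup_iff' _ _).1 hZ.right_mem
  have : Z * R = S * rectDiag m n θ := by rw [hZ.eq, Matrix.mul_assoc, hR, Matrix.mul_one]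
  rw [Matrix.mul_assoc, this, hZ.eq]
  simp only [Matrix.transpose_mul, Matrix.transpose_transpose]
  rw [← rectDiag_transpose_mul_rectDiag h]
  simp only [Matrix.mul_assoc]
  rw [← Matrix.mul_assoc Sᵀ, hS, Matrix.one_mul]

/-! ### The normalized objective and its rotation invariance. -/

/-- The part of `loss` that depends on the weights, in the parameters `p = σ₁²`, `q = σ₂²`,
`k = β₂ c² / β₁` and `β = β₁`. -/
def energy {D n d : ℕ} (p q k β : ℝ) (Z : Matrix (Fin D) (Fin n) ℝ)
    (U₁ : Matrix (Fin D) (Fin d) ℝ) (U₂ : Matrix (Fin d) (Fin d) ℝ)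
    (V₁ : Matrix (Fin d) (Fin n) ℝ) (W₂ : Matrix (Fin d) (Fin d) ℝ) : ℝ :=
  (frobSq (U₁ * V₁ - Z) + p * frobSq U₁)
    + β * ((frobSq ((U₂ * W₂ - 1) * V₁) + p * frobSq (U₂ * W₂ - 1))
      + k * (frobSq (W₂ * V₁) + p * frobSq W₂))
    + β * q * frobSq U₂

lemma frobSq_eq_trace {m n : ℕ} (M : Matrix (Fin m) (Fin n) ℝ) :
    frobSq M = (M * Mᵀ).trace := by
  simp [frobSq, Matrix.trace, Matrix.mul_apply, sq]

lemma trace_transpose_mul_self {m n : ℕ} (M : Matrix (Fin m) (Fin n) ℝ) (t : ℝ) :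
    (Mᵀ * M * (t • (1 : Matrix (Fin n) (Fin n) ℝ))).trace = t * frobSq M := by
  rw [frobSq_eq_trace, Matrix.mul_smul, Matrix.trace_smul, Matrix.mul_one, Matrix.trace_mul_comm,
    smul_eq_mul]

lemma loss_le_loss_iff {D n d : ℕ} {ηdec ηenc β₁ β₂ σ₁ σ₂ c : ℝ} (hηdec : 0 < ηdec)
    (hβ₁ : 0 < β₁) (hc : c = ηdec / ηenc) (Z : Matrix (Fin D) (Fin n) ℝ)
    (U₁ U₁' : Matrix (Fin D) (Fin d) ℝ) (U₂ U₂' : Matrix (Fin d) (Fin d) ℝ)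
    (V₁ V₁' : Matrix (Fin d) (Fin n) ℝ) (W₂ W₂' : Matrix (Fin d) (Fin d) ℝ) :
    loss ηdec ηenc β₁ β₂ Z (σ₁ ^ 2 • 1) (σ₂ ^ 2 • 1) U₁ U₂ V₁ W₂ ≤
        loss ηdec ηenc β₁ β₂ Z (σ₁ ^ 2 • 1) (σ₂ ^ 2 • 1) U₁' U₂' V₁' W₂' ↔
      energy (σ₁ ^ 2) (σ₂ ^ 2) (β₂ / β₁ * c ^ 2) β₁ Z U₁ U₂ V₁ W₂ ≤
        energy (σ₁ ^ 2) (σ₂ ^ 2) (β₂ / β₁ * c ^ 2) β₁ Z U₁' U₂' V₁' W₂' := by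
  have key (U₁ : Matrix (Fin D) (Fin d) ℝ) (U₂ : Matrix (Fin d) (Fin d) ℝ)
      (V₁ : Matrix (Fin d) (Fin n) ℝ) (W₂ : Matrix (Fin d) (Fin d) ℝ) :
      loss ηdec ηenc β₁ β₂ Z (σ₁ ^ 2 • 1) (σ₂ ^ 2 • 1) U₁ U₂ V₁ W₂ =
        1 / ηdec ^ 2 * energy (σ₁ ^ 2) (σ₂ ^ 2) (β₂ / β₁ * c ^ 2) β₁ Z U₁ U₂ V₁ W₂ +
        (1 / ηdec ^ 2 * (β₂ * c ^ 2 * (σ₂ ^ 2 • (1 : Matrix (Fin d) (Fin d) ℝ)).trace)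
          - β₁ * Real.log (σ₁ ^ 2 • (1 : Matrix (Fin d) (Fin d) ℝ)).det
          - β₂ * Real.log (σ₂ ^ 2 • (1 : Matrix (Fin d) (Fin d) ℝ)).det) := by
    simp only [loss, energy, trace_transpose_mul_self, ← hc]
    have : β₂ = β₁ * (β₂ / β₁) := by field_simp
    generalize β₂ / β₁ = r at *
    subst this
    ring
  rw [key, key, add_le_add_iff_right, mul_le_mul_iff_right₀ (by positivity)]

section Conj

variable {m n d : ℕ} {P : Matrix (Fin d) (Fin d) ℝ}

lemma frobSq_mul_orthogonal (hP : P * Pᵀ = 1) (M : Matrix (Fin m) (Fin d) ℝ) :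
    frobSq (M * P) = frobSq M := by
  rw [frobSq_eq_trace, frobSq_eq_trace, Matrix.transpose_mul, Matrix.mul_assoc,
    ← Matrix.mul_assoc P, hP, Matrix.one_mul]

lemma frobSq_transpose_mul (hP : P * Pᵀ = 1) (M : Matrix (Fin d) (Fin n) ℝ) :
    frobSq (Pᵀ * M) = frobSq M := by
  rw [frobSq_eq_trace, frobSq_eq_trace, Matrix.transpose_mul, Matrix.mul_assoc,
    Matrix.trace_mul_comm, Matrix.mul_assoc, Matrix.mul_assoc, Matrix.transpose_transpose, hP,
    Matrix.mul_one]

/-- The objective does not depend on the orthonormal basis of the first latent space. -/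
lemma energy_conj (hP : P ∈ Matrix.orthogonalGroup (Fin d) ℝ) (p q k β : ℝ)
    (Z : Matrix (Fin m) (Fin n) ℝ) (U₁ : Matrix (Fin m) (Fin d) ℝ)
    (U₂ : Matrix (Fin d) (Fin d) ℝ) (V₁ : Matrix (Fin d) (Fin n) ℝ)
    (W₂ : Matrix (Fin d) (Fin d) ℝ) :
    energy p q k β Z (U₁ * P) (Pᵀ * U₂) (Pᵀ * V₁) (W₂ * P) = energy p q k β Z U₁ U₂ V₁ W₂ := by
  have h1 : P * Pᵀ = 1 := (Matrix.mem_orthogonalGroup_iff _ _).1 hP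
  have h2 : Pᵀ * P = 1 := (Matrix.mem_orthogonalGroup_iff' _ _).1 hP
  have cancel {l r : ℕ} (A : Matrix (Fin l) (Fin d) ℝ) (B : Matrix (Fin d) (Fin r) ℝ) :
      A * P * (Pᵀ * B) = A * B := by
    rw [Matrix.mul_assoc, ← Matrix.mul_assoc P, h1, Matrix.one_mul]
  have e : Pᵀ * U₂ * (W₂ * P) - 1 = Pᵀ * (U₂ * W₂ - 1) * P := by
    rw [Matrix.mul_sub, Matrix.sub_mul, Matrix.mul_one, h2]
    simp only [Matrix.mul_assoc]
  have e' : Pᵀ * (U₂ * W₂ - 1) * P * (Pᵀ * V₁) = Pᵀ * ((U₂ * W₂ - 1) * V₁) := by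
    rw [cancel, Matrix.mul_assoc]
  simp only [energy, e, e', cancel, frobSq_mul_orthogonal h1, frobSq_transpose_mul h1]

end Conj

/-! ### Completing the squares when `V₁ V₁ᵀ` is diagonal. -/

section Diagonal

variable {m n d : ℕ} {V : Matrix (Fin d) (Fin n) ℝ} {a : Fin d → ℝ}

lemma frobSq_mul_of_mul_transpose_eq (hV : V * Vᵀ = Matrix.diagonal a)
    (M : Matrix (Fin m) (Fin d) ℝ) : frobSq (M * V) = ∑ i, a i * ∑ l, M l i ^ 2 := by
  rw [frobSq_eq_trace, Matrix.transpose_mul, Matrix.mul_assoc, ← Matrix.mul_assoc V, hV]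
  simp only [Matrix.trace, Matrix.diag_apply, Matrix.mul_apply, Matrix.diagonal_apply, ite_mul,
    zero_mul, Finset.sum_ite_eq, Finset.mem_univ, if_true, Matrix.transpose_apply, Finset.mul_sum]
  rw [Finset.sum_comm]
  exact Finset.sum_congr rfl fun _ _ => Finset.sum_congr rfl fun _ _ => by ring

/-- The noise term adds `p` to the Gram matrix of `V`, so the columns of `M` decouple with weights
`a i + p`. -/
lemma frobSq_mul_add_mul_frobSq (hV : V * Vᵀ = Matrix.diagonal a) (p : ℝ)
    (M : Matrix (Fin m) (Fin d) ℝ) :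
    frobSq (M * V) + p * frobSq M = ∑ i, (a i + p) * ∑ l, M l i ^ 2 := by
  rw [frobSq_mul_of_mul_transpose_eq hV, frobSq, Finset.sum_comm, Finset.mul_sum,
    ← Finset.sum_add_distrib]
  exact Finset.sum_congr rfl fun _ _ => by ring

lemma frobSq_sub (A B : Matrix (Fin m) (Fin n) ℝ) :
    frobSq (A - B) = frobSq A - 2 * (A * Bᵀ).trace + frobSq B := by
  simp only [frobSq, Matrix.trace, Matrix.diag_apply, Matrix.mul_apply, Matrix.transpose_apply,
    Matrix.sub_apply, Finset.mul_sum, ← Finset.sum_add_distrib, ← Finset.sum_sub_distrib]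
  exact Finset.sum_congr rfl fun _ _ => Finset.sum_congr rfl fun _ _ => by ring

lemma frobSq_mul_sub_add (hV : V * Vᵀ = Matrix.diagonal a) {p : ℝ} (hp : ∀ i, a i + p ≠ 0)
    (U : Matrix (Fin m) (Fin d) ℝ) (Z : Matrix (Fin m) (Fin n) ℝ) :
    frobSq (U * V - Z) + p * frobSq U = frobSq Z - ∑ i, (∑ l, (Z * Vᵀ) l i ^ 2) / (a i + p) +
      ∑ i, (a i + p) * ∑ l, (U l i - (Z * Vᵀ) l i / (a i + p)) ^ 2 := by
  have e : (U * V * Zᵀ).trace = ∑ i, ∑ l, U l i * (Z * Vᵀ) l i := by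
    have : V * Zᵀ = (Z * Vᵀ)ᵀ := by simp
    rw [Matrix.mul_assoc, this, Finset.sum_comm]
    simp [Matrix.trace, Matrix.mul_apply, mul_comm]
  have h := frobSq_mul_add_mul_frobSq hV p U
  rw [frobSq_sub, e]
  have : ∑ i, (a i + p) * ∑ l, (U l i - (Z * Vᵀ) l i / (a i + p)) ^ 2 =
      ∑ i, (a i + p) * ∑ l, U l i ^ 2 - 2 * ∑ i, ∑ l, U l i * (Z * Vᵀ) l i +
        ∑ i, (∑ l, (Z * Vᵀ) l i ^ 2) / (a i + p) := by
    simp only [Finset.mul_sum, Finset.sum_div, ← Finset.sum_add_distrib, ← Finset.sum_sub_distrib]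
    refine Finset.sum_congr rfl fun i _ => Finset.sum_congr rfl fun l _ => ?_
    have := hp i
    field_simp
    ring
  rw [this, ← h]
  ring

/-- Ridge regression of the scalar 1 on `u`: the minimum over `w` is `k / (|u|² + k)`, at `w = u /
(|u|² + k)`. -/
lemma sq_sub_one_add_mul_sum_sq {k : ℝ} (hk : 0 < k) (u w : Fin n → ℝ) :
    (∑ l, u l * w l - 1) ^ 2 + k * ∑ l, w l ^ 2 = k / (∑ l, u l ^ 2 + k) +
      ((∑ l, u l * (w l - u l / (∑ l, u l ^ 2 + k))) ^ 2 +
        k * ∑ l, (w l - u l / (∑ l, u l ^ 2 + k)) ^ 2) := by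
  set b := ∑ l, u l ^ 2 with hb
  have hbk : 0 < b + k := add_pos_of_nonneg_of_pos (Finset.sum_nonneg fun _ _ => sq_nonneg _) hk
  have e1 : ∑ l, u l * (w l - u l / (b + k)) = ∑ l, u l * w l - b / (b + k) := by
    rw [hb, Finset.sum_div, ← Finset.sum_sub_distrib]
    exact Finset.sum_congr rfl fun _ _ => by ring
  have e2 : ∑ l, (w l - u l / (b + k)) ^ 2 =
      ∑ l, w l ^ 2 - 2 / (b + k) * ∑ l, u l * w l + b / (b + k) ^ 2 := by
    nth_rw 2 [hb]
    rw [Finset.sum_div, Finset.mul_sum, ← Finset.sum_sub_distrib, ← Finset.sum_add_distrib]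
    refine Finset.sum_congr rfl fun _ _ => by field_simp; ring
  rw [e1, e2]
  field_simp
  ring

/-- The nonnegative defect by which the objective exceeds its minimum over `U₁` and `W₂` and
over the directions of the rows of `U₂`, when `V₁ V₁ᵀ` is diagonal. -/
def excess (p k β : ℝ) (Z : Matrix (Fin m) (Fin n) ℝ) (a : Fin d → ℝ)
    (U₁ : Matrix (Fin m) (Fin d) ℝ) (U : Matrix (Fin d) (Fin d) ℝ)
    (V : Matrix (Fin d) (Fin n) ℝ) (W : Matrix (Fin d) (Fin d) ℝ) : ℝ :=
  ∑ i, (a i + p) * ∑ l, (U₁ l i - (Z * Vᵀ) l i / (a i + p)) ^ 2 +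
    β * ∑ i, (a i + p) * ((∑ l, U i l * (W l i - U i l / (∑ l, U i l ^ 2 + k))) ^ 2 +
      k * ∑ l, (W l i - U i l / (∑ l, U i l ^ 2 + k)) ^ 2 +
      ∑ j ∈ Finset.univ.erase i, (U * W) j i ^ 2)

/-- Column `i` of `U W - 1` has one diagonal entry, which is a ridge problem in row `i` of `U` and
column `i` of `W`. Its off-diagonal entries only add cost and go into the excess. -/
lemma energy_eq_add_excess (hV : V * Vᵀ = Matrix.diagonal a) {p q k β : ℝ} (hk : 0 < k)
    (hp : ∀ i, a i + p ≠ 0)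
    (Z : Matrix (Fin m) (Fin n) ℝ) (U₁ : Matrix (Fin m) (Fin d) ℝ)
    (U W : Matrix (Fin d) (Fin d) ℝ) :
    energy p q k β Z U₁ U V W = frobSq Z +
      ∑ i, (β * k * (a i + p) / (∑ l, U i l ^ 2 + k) + β * q * ∑ l, U i l ^ 2 -
        (∑ l, (Z * Vᵀ) l i ^ 2) / (a i + p)) + excess p k β Z a U₁ U V W := by
  have key : (frobSq ((U * W - 1) * V) + p * frobSq (U * W - 1)) +
      k * (frobSq (W * V) + p * frobSq W) =
      ∑ i, (a i + p) * (k / (∑ l, U i l ^ 2 + k)) +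
      ∑ i, (a i + p) * ((∑ l, U i l * (W l i - U i l / (∑ l, U i l ^ 2 + k))) ^ 2 +
      k * ∑ l, (W l i - U i l / (∑ l, U i l ^ 2 + k)) ^ 2 +
      ∑ j ∈ Finset.univ.erase i, (U * W) j i ^ 2) := by
    rw [frobSq_mul_add_mul_frobSq hV, frobSq_mul_add_mul_frobSq hV, Finset.mul_sum,
      ← Finset.sum_add_distrib, ← Finset.sum_add_distrib]
    refine Finset.sum_congr rfl fun i _ => ?_
    have e : ∑ l, (U * W - 1) l i ^ 2 = (∑ l, U i l * W l i - 1) ^ 2 +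
        ∑ j ∈ Finset.univ.erase i, (U * W) j i ^ 2 := by
      rw [← Finset.add_sum_erase _ _ (Finset.mem_univ i)]
      congr 1
      · simp [Matrix.mul_apply]
      · refine Finset.sum_congr rfl fun j hj => ?_
        simp [Matrix.one_apply_ne (Finset.ne_of_mem_erase hj)]
    rw [e]
    linear_combination (a i + p) * sq_sub_one_add_mul_sum_sq hk (U i) (fun l => W l i)
  rw [energy, key, frobSq_mul_sub_add hV hp, excess]
  simp only [frobSq, Finset.sum_sub_distrib, Finset.sum_add_distrib]
  have h1 : ∑ i, β * k * (a i + p) / (∑ l, U i l ^ 2 + k) =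
      β * ∑ i, (a i + p) * (k / (∑ l, U i l ^ 2 + k)) := by
    rw [Finset.mul_sum]
    exact Finset.sum_congr rfl fun _ _ => by ring
  rw [h1, ← Finset.mul_sum (f := fun i => ∑ l, U i l ^ 2)]
  ring

lemma excess_nonneg {p k β : ℝ} (hk : 0 < k) (hβ : 0 < β) (hp : ∀ i, 0 < a i + p)
    (Z : Matrix (Fin m) (Fin n) ℝ) (U₁ : Matrix (Fin m) (Fin d) ℝ)
    (U W : Matrix (Fin d) (Fin d) ℝ) : 0 ≤ excess p k β Z a U₁ U V W := by
  have h (i) := (hp i).le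
  unfold excess
  refine add_nonneg (Finset.sum_nonneg fun i _ => mul_nonneg (h i) (by positivity))
    (mul_nonneg hβ.le (Finset.sum_nonneg fun i _ => mul_nonneg (h i) (by positivity)))

lemma excess_eq_zero {p k β : ℝ} (hk : 0 < k) (hβ : 0 < β) (hp : ∀ i, 0 < a i + p)
    {Z : Matrix (Fin m) (Fin n) ℝ} {U₁ : Matrix (Fin m) (Fin d) ℝ}
    {U W : Matrix (Fin d) (Fin d) ℝ} (h0 : excess p k β Z a U₁ U V W = 0) :
    (∀ l i, U₁ l i = (Z * Vᵀ) l i / (a i + p)) ∧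
      (∀ l i, W l i = U i l / (∑ l, U i l ^ 2 + k)) ∧
      ∀ i j, i ≠ j → (U * Uᵀ) j i = 0 := by
  have h (i) := (hp i).le
  rw [excess, add_eq_zero_iff_of_nonneg
    (Finset.sum_nonneg fun i _ => mul_nonneg (h i) (by positivity))
    (mul_nonneg hβ.le (Finset.sum_nonneg fun i _ => mul_nonneg (h i) (by positivity))),
    mul_eq_zero_iff_left hβ.ne',
    Finset.sum_eq_zero_iff_of_nonneg (fun i _ => mul_nonneg (h i) (by positivity)),
    Finset.sum_eq_zero_iff_of_nonneg (fun i _ => mul_nonneg (h i) (by positivity))] at h0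
  obtain ⟨hA, hB⟩ := h0
  have hW : ∀ l i, W l i = U i l / (∑ l, U i l ^ 2 + k) := by
    intro l i
    have h1 := (mul_eq_zero_iff_left (hp i).ne').1 (hB i (Finset.mem_univ i))
    rw [add_eq_zero_iff_of_nonneg (by positivity) (by positivity),
      add_eq_zero_iff_of_nonneg (by positivity) (by positivity)] at h1
    have h2 := (mul_eq_zero_iff_left hk.ne').1 h1.1.2
    rw [Finset.sum_eq_zero_iff_of_nonneg (fun _ _ => sq_nonneg _)] at h2
    have := h2 l (Finset.mem_univ l)
    exact sub_eq_zero.1 (pow_eq_zero_iff two_ne_zero |>.1 this)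
  refine ⟨fun l i => ?_, hW, fun i j hij => ?_⟩
  · have h1 := (mul_eq_zero_iff_left (hp i).ne').1 (hA i (Finset.mem_univ i))
    rw [Finset.sum_eq_zero_iff_of_nonneg (fun _ _ => sq_nonneg _)] at h1
    exact sub_eq_zero.1 (pow_eq_zero_iff two_ne_zero |>.1 (h1 l (Finset.mem_univ l)))
  · have h1 := (mul_eq_zero_iff_left (hp i).ne').1 (hB i (Finset.mem_univ i))
    rw [add_eq_zero_iff_of_nonneg (by positivity) (by positivity)] at h1
    have h2 := h1.2
    rw [Finset.sum_eq_zero_iff_of_nonneg (fun _ _ => sq_nonneg _)] at h2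
    have h3 := pow_eq_zero_iff two_ne_zero |>.1
      (h2 j (Finset.mem_erase.2 ⟨hij.symm, Finset.mem_univ j⟩))
    have hb : 0 < ∑ l, U i l ^ 2 + k := by positivity
    -- Since column `i` of `W` is a multiple of row `i` of `U`, vanishing off-diagonal entries of `U
    -- W` mean orthogonal rows of `U`.
    have h4 : (U * W) j i = (U * Uᵀ) j i / (∑ l, U i l ^ 2 + k) := by
      simp only [Matrix.mul_apply, hW, Matrix.transpose_apply, Finset.sum_div]
      exact Finset.sum_congr rfl fun _ _ => by ring
    rw [h4] at h3
    exact (div_eq_zero_iff.1 h3).resolve_right hb.ne'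

end Diagonal

/-! ### Ridge solutions and the value at aligned points. -/

section Formulas

variable {m n d : ℕ}

/-- The rotation `P` diagonalizes the matrix to be inverted. The case `A = Z`, `B = V₁` gives `U₁`,
and `A = 1`, `B = U₂` gives `W₂`. -/
lemma eq_mul_transpose_mul_inv_iff {P : Matrix (Fin d) (Fin d) ℝ}
    (hP : P ∈ Matrix.orthogonalGroup (Fin d) ℝ) {B : Matrix (Fin d) (Fin n) ℝ} {a : Fin d → ℝ}
    (hB : Pᵀ * B * (Pᵀ * B)ᵀ = Matrix.diagonal a) {p : ℝ} (hp : ∀ i, a i + p ≠ 0)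
    (A : Matrix (Fin m) (Fin n) ℝ) (X : Matrix (Fin m) (Fin d) ℝ) :
    X = A * Bᵀ * (B * Bᵀ + p • (1 : Matrix (Fin d) (Fin d) ℝ))⁻¹ ↔
      ∀ l i, (X * P) l i = (A * (Pᵀ * B)ᵀ) l i / (a i + p) := by
  have h1 : P * Pᵀ = 1 := (Matrix.mem_orthogonalGroup_iff _ _).1 hP
  have h2 : Pᵀ * P = 1 := (Matrix.mem_orthogonalGroup_iff' _ _).1 hP
  have hD : Matrix.diagonal (fun i => a i + p) =
      Matrix.diagonal a + p • (1 : Matrix (Fin d) (Fin d) ℝ) := by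
    rw [← Matrix.diagonal_one, ← Matrix.diagonal_smul, Matrix.diagonal_add]
    simp
  have hC : Pᵀ * (B * Bᵀ + p • (1 : Matrix (Fin d) (Fin d) ℝ)) * P =
      Matrix.diagonal (fun i => a i + p) := by
    rw [hD, ← hB, Matrix.mul_add, Matrix.add_mul]
    simp only [Matrix.transpose_mul, Matrix.transpose_transpose, Matrix.mul_assoc, Matrix.mul_smul,
      Matrix.smul_mul, Matrix.one_mul, h2]
  set C := B * Bᵀ + p • (1 : Matrix (Fin d) (Fin d) ℝ) with hCdef
  have hdet : IsUnit C.det := by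
    have e := congrArg Matrix.det hC
    rw [Matrix.det_mul, Matrix.det_mul, Matrix.det_diagonal, mul_right_comm, ← Matrix.det_mul, h2,
      Matrix.det_one, one_mul] at e
    rw [e, isUnit_iff_ne_zero]
    exact Finset.prod_ne_zero_iff.2 fun i _ => hp i
  have e1 : X = A * Bᵀ * C⁻¹ ↔ X * C = A * Bᵀ := by
    constructor
    · rintro rfl
      rw [Matrix.mul_assoc, Matrix.nonsing_inv_mul _ hdet, Matrix.mul_one]
    · intro h
      rw [← h, Matrix.mul_assoc, Matrix.mul_nonsing_inv _ hdet, Matrix.mul_one]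
  have e2 : X * C = A * Bᵀ ↔ X * P * Matrix.diagonal (fun i => a i + p) = A * (Pᵀ * B)ᵀ := by
    rw [← hC, Matrix.transpose_mul, Matrix.transpose_transpose, ← Matrix.mul_assoc A]
    have : X * P * (Pᵀ * C * P) = X * C * P := by
      rw [← Matrix.mul_assoc, ← Matrix.mul_assoc, Matrix.mul_assoc X, h1, Matrix.mul_one]
    rw [this]
    refine ⟨fun h => by rw [h], fun h => ?_⟩
    have := congrArg (· * Pᵀ) h
    simpa only [Matrix.mul_assoc, h1, Matrix.mul_one] using this
  rw [e1, e2, ← Matrix.ext_iff]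
  refine forall_congr' fun l => forall_congr' fun i => ?_
  rw [Matrix.mul_diagonal, eq_div_iff (hp i)]

lemma diagonal_mul_mul_transpose {N : Matrix (Fin d) (Fin n) ℝ} (hN : N * Nᵀ = 1)
    (lam : Fin d → ℝ) : Matrix.diagonal lam * N * (Matrix.diagonal lam * N)ᵀ =
      Matrix.diagonal (fun i => lam i ^ 2) := by
  rw [Matrix.transpose_mul, Matrix.mul_assoc, ← Matrix.mul_assoc N, hN, Matrix.one_mul,
    Matrix.diagonal_transpose, Matrix.diagonal_mul_diagonal]
  simp [sq]

/-- Keeping the unit directions `N` apart from their lengths `lam` gives every row a direction even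
where `V` vanishes, and turns each summand into a `cell`. -/
lemma energy_diagonal_mul {N : Matrix (Fin d) (Fin n) ℝ} (hN : N * Nᵀ = 1) {p q k β : ℝ}
    (hp : 0 < p) (hk : 0 < k) (Z : Matrix (Fin m) (Fin n) ℝ) (U₁ : Matrix (Fin m) (Fin d) ℝ)
    (U W : Matrix (Fin d) (Fin d) ℝ) (lam : Fin d → ℝ) :
    energy p q k β Z U₁ U (Matrix.diagonal lam * N) W = frobSq Z +
      ∑ i, cell p q k β (∑ l, (Z * Nᵀ) l i ^ 2) (lam i ^ 2) (∑ l, U i l ^ 2) +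
      excess p k β Z (fun i => lam i ^ 2) U₁ U (Matrix.diagonal lam * N) W := by
  rw [energy_eq_add_excess (diagonal_mul_mul_transpose hN lam) hk (fun i => by positivity)]
  congr 2
  refine Finset.sum_congr rfl fun i _ => ?_
  have : ∑ l, (Z * (Matrix.diagonal lam * N)ᵀ) l i ^ 2 = lam i ^ 2 * ∑ l, (Z * Nᵀ) l i ^ 2 := by
    rw [Matrix.transpose_mul, Matrix.diagonal_transpose, ← Matrix.mul_assoc, Finset.mul_sum]
    exact Finset.sum_congr rfl fun l _ => by rw [Matrix.mul_diagonal]; ring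
  rw [this, cell]
  ring

lemma orthogonal_transpose_mul_cancel {P : Matrix (Fin d) (Fin d) ℝ}
    (hP : P ∈ Matrix.orthogonalGroup (Fin d) ℝ) (M : Matrix (Fin d) (Fin n) ℝ) :
    Pᵀ * (P * M) = M := by
  rw [← Matrix.mul_assoc, show Pᵀ * P = 1 from (Matrix.mem_orthogonalGroup_iff' _ _).1 hP,
    Matrix.one_mul]

lemma orthogonal_mul_transpose_cancel {P : Matrix (Fin d) (Fin d) ℝ}
    (hP : P ∈ Matrix.orthogonalGroup (Fin d) ℝ) (M : Matrix (Fin d) (Fin n) ℝ) :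
    P * (Pᵀ * M) = M := by
  rw [← Matrix.mul_assoc, show P * Pᵀ = 1 from (Matrix.mem_orthogonalGroup_iff _ _).1 hP,
    Matrix.one_mul]

/-- The value of the objective when `V₁` and `U₂` share their left singular vectors and `U₁` and
`W₂` solve their least squares problems. -/
lemma energy_of_aligned {P Q : Matrix (Fin d) (Fin d) ℝ}
    (hP : P ∈ Matrix.orthogonalGroup (Fin d) ℝ) (hQ : Q ∈ Matrix.orthogonalGroup (Fin d) ℝ)
    {N : Matrix (Fin d) (Fin n) ℝ} (hN : N * Nᵀ = 1) {p q k β : ℝ} (hp : 0 < p) (hk : 0 < k)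
    {Z : Matrix (Fin m) (Fin n) ℝ} {U₁ : Matrix (Fin m) (Fin d) ℝ}
    {U W : Matrix (Fin d) (Fin d) ℝ} {V : Matrix (Fin d) (Fin n) ℝ} {lam om : Fin d → ℝ}
    (hV : V = P * (Matrix.diagonal lam * N)) (hU : U = P * (Matrix.diagonal om * Qᵀ))
    (hW : W = Uᵀ * (U * Uᵀ + k • (1 : Matrix (Fin d) (Fin d) ℝ))⁻¹)
    (hU₁ : U₁ = Z * Vᵀ * (V * Vᵀ + p • (1 : Matrix (Fin d) (Fin d) ℝ))⁻¹) :
    energy p q k β Z U₁ U V W = frobSq Z +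
      ∑ i, cell p q k β (∑ l, (Z * Nᵀ) l i ^ 2) (lam i ^ 2) (om i ^ 2) := by
  have hQ1 : Qᵀ * Qᵀᵀ = 1 := by
    rw [Matrix.transpose_transpose]; exact (Matrix.mem_orthogonalGroup_iff' _ _).1 hQ
  have hPV : Pᵀ * V = Matrix.diagonal lam * N := by rw [hV, orthogonal_transpose_mul_cancel hP]
  have hPU : Pᵀ * U = Matrix.diagonal om * Qᵀ := by rw [hU, orthogonal_transpose_mul_cancel hP]
  have hUU := diagonal_mul_mul_transpose hQ1 om
  have hb (i) : ∑ l, (Matrix.diagonal om * Qᵀ) i l ^ 2 = om i ^ 2 := by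
    have := congrFun₂ hUU i i
    rw [Matrix.diagonal_apply_eq, Matrix.mul_apply] at this
    rw [← this]
    exact Finset.sum_congr rfl fun _ _ => by rw [Matrix.transpose_apply, sq]
  have fU₁ := (eq_mul_transpose_mul_inv_iff hP (by rw [hPV]; exact diagonal_mul_mul_transpose hN lam)
    (fun i => by positivity) Z U₁).1 hU₁
  have fW := (eq_mul_transpose_mul_inv_iff (p := k) hP (by rw [hPU]; exact hUU)
    (fun i => by positivity) 1 W).1 (by rw [Matrix.one_mul]; exact hW)
  rw [hPV] at fU₁
  rw [hPU, Matrix.one_mul] at fW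
  rw [← energy_conj hP, hPV, hPU, energy_diagonal_mul hN hp hk, excess]
  simp only [hb]
  have z1 (i l) : (W * P) l i - (Matrix.diagonal om * Qᵀ) i l / (om i ^ 2 + k) = 0 := by
    rw [fW, Matrix.transpose_apply, sub_self]
  have z2 (i j) (hij : i ≠ j) : (Matrix.diagonal om * Qᵀ * (W * P)) j i = 0 := by
    have e : W * P = (Matrix.diagonal om * Qᵀ)ᵀ * Matrix.diagonal (fun i => (om i ^ 2 + k)⁻¹) := by
      ext l i
      rw [fW, Matrix.mul_diagonal, div_eq_mul_inv]
    rw [e, ← Matrix.mul_assoc, hUU, Matrix.diagonal_mul_diagonal, Matrix.diagonal_apply_ne _ hij.symm]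
  have z3 (i) : ∑ j ∈ Finset.univ.erase i, (Matrix.diagonal om * Qᵀ * (W * P)) j i ^ 2 = 0 :=
    Finset.sum_eq_zero fun j hj => by
      rw [z2 i j (Finset.ne_of_mem_erase hj).symm, zero_pow two_ne_zero]
  simp only [z1, z3, fU₁]
  simp

end Formulas

/-! ### The Ky Fan type lower bound. -/

section LowerBound

variable {m n d : ℕ}

/-- Total mass `d`, at most 1 at each place, is cheapest on the `d` smallest values of `g`.
Subtracting the pivot `t`, the last of these values, makes the terms inside the block nonpositive
and those outside nonnegative. -/
lemma sum_castLE_le_sum_mul (h : d ≤ n) {D : Fin d → Fin n → ℝ} (hD : ∀ i j, 0 ≤ D i j)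
    (hrow : ∀ i, ∑ j, D i j = 1) (hcol : ∀ j, ∑ i, D i j ≤ 1) {g : Fin n → ℝ} (hg : Monotone g) :
    ∑ i, g (Fin.castLE h i) ≤ ∑ i, ∑ j, D i j * g j := by
  rcases Nat.eq_zero_or_pos d with rfl | hd
  · simp
  set t := g ⟨d - 1, by omega⟩ with ht
  have e1 : ∑ i : Fin d, ∑ j, D i j * g j =
      d * t + ∑ j, (∑ i, D i j) * (g j - t) := by
    simp only [Finset.sum_mul, mul_sub, Finset.sum_sub_distrib]
    rw [Finset.sum_comm (f := fun i j => D i j * g j), Finset.sum_comm (f := fun j i => D i j * t)]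
    simp only [← Finset.sum_mul, hrow]
    simp
  have e2 : ∑ i : Fin d, g (Fin.castLE h i) = d * t + ∑ i : Fin d, (g (Fin.castLE h i) - t) := by
    rw [Finset.sum_sub_distrib]; simp
  rw [e1, e2]
  gcongr
  have e3 : ∑ i : Fin d, (g (Fin.castLE h i) - t) =
      ∑ j ∈ Finset.univ.map (Fin.castLEEmb h), (g j - t) := by simp
  rw [e3]
  have hle : ∑ j ∈ Finset.univ.map (Fin.castLEEmb h), (g j - t) ≤
      ∑ j ∈ Finset.univ.map (Fin.castLEEmb h), (∑ i, D i j) * (g j - t) := by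
    refine Finset.sum_le_sum fun j hj => ?_
    obtain ⟨i, -, rfl⟩ := Finset.mem_map.1 hj
    have : g (Fin.castLEEmb h i) ≤ t := hg (by rw [Fin.le_def]; simp; omega)
    nlinarith [hcol (Fin.castLEEmb h i)]
  refine hle.trans (Finset.sum_le_sum_of_subset_of_nonneg (Finset.subset_univ _) fun j _ hj => ?_)
  refine mul_nonneg (Finset.sum_nonneg fun i _ => hD i j) (sub_nonneg.2 (hg ?_))
  rw [Fin.le_def]
  by_contra! hlt
  exact hj (Finset.mem_map.2 ⟨⟨j, by simp at hlt; omega⟩, Finset.mem_univ _, Fin.ext (by simp)⟩)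

/-- The sum is a diagonal entry of the projection `G = Eᵀ E`, and `G j j = ∑ l, G j l ^ 2 ≥ G j j ^
2`. -/
lemma sum_sq_col_le_one {E : Matrix (Fin d) (Fin n) ℝ} (hE : E * Eᵀ = 1) (j : Fin n) :
    ∑ i, E i j ^ 2 ≤ 1 := by
  set G := Eᵀ * E with hG
  have hGG : G * G = G := by
    rw [hG, Matrix.mul_assoc, ← Matrix.mul_assoc E, hE, Matrix.one_mul]
  have hsymm (l) : G l j = G j l := by
    simp only [hG, Matrix.mul_apply, Matrix.transpose_apply]
    exact Finset.sum_congr rfl fun _ _ => mul_comm _ _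
  have e : G j j = ∑ i, E i j ^ 2 := by
    simp only [hG, Matrix.mul_apply, Matrix.transpose_apply, sq]
  have e2 : G j j = ∑ l, G j l ^ 2 := by
    conv_lhs => rw [← hGG, Matrix.mul_apply]
    exact Finset.sum_congr rfl fun l _ => by rw [hsymm, sq]
  have h3 : G j j ^ 2 ≤ G j j := by
    conv_rhs => rw [e2]
    exact Finset.single_le_sum (f := fun l => G j l ^ 2) (fun _ _ => sq_nonneg _)
      (Finset.mem_univ j)
  rw [← e]
  nlinarith

lemma sum_sq_row_eq_one {E : Matrix (Fin d) (Fin n) ℝ} (hE : E * Eᵀ = 1) (i : Fin d) :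
    ∑ j, E i j ^ 2 = 1 := by
  have := congrFun₂ hE i i
  rw [Matrix.one_apply_eq, Matrix.mul_apply] at this
  rw [← this]
  exact Finset.sum_congr rfl fun _ _ => by rw [Matrix.transpose_apply, sq]

lemma sum_sq_mul_transpose {Z : Matrix (Fin m) (Fin n) ℝ} {R : Matrix (Fin n) (Fin n) ℝ}
    (hR : R ∈ Matrix.orthogonalGroup (Fin n) ℝ) {μ : Fin n → ℝ}
    (hZ : Zᵀ * Z * R = R * Matrix.diagonal μ) (N : Matrix (Fin d) (Fin n) ℝ) (i : Fin d) :
    ∑ l, (Z * Nᵀ) l i ^ 2 = ∑ j, (N * R) i j ^ 2 * μ j := by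
  have h1 : R * Rᵀ = 1 := (Matrix.mem_orthogonalGroup_iff _ _).1 hR
  have hZ' : Zᵀ * Z = R * Matrix.diagonal μ * Rᵀ := by
    rw [← hZ, Matrix.mul_assoc, h1, Matrix.mul_one]
  have e : (Z * Nᵀ)ᵀ * (Z * Nᵀ) = N * R * Matrix.diagonal μ * (N * R)ᵀ := by
    rw [Matrix.transpose_mul, Matrix.transpose_transpose, Matrix.mul_assoc, ← Matrix.mul_assoc Zᵀ,
      hZ', Matrix.transpose_mul]
    simp only [Matrix.mul_assoc]
  have e' := congrFun₂ e i i
  rw [Matrix.mul_apply, Matrix.mul_apply] at e'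
  simp only [Matrix.mul_diagonal, Matrix.transpose_apply] at e'
  simp only [sq]
  rw [e']
  exact Finset.sum_congr rfl fun _ _ => by ring

/-- The sum of the cells at orthonormal directions with coefficients `E` in an eigenbasis is at
least the sum of the optimal cells at the leading eigenvalues. -/
lemma sum_cell_ge (h : d ≤ n) {p q k β : ℝ} (hp : 0 < p) (hk : 0 < k) (hβ : 0 < β)
    {μ A B : Fin n → ℝ} (hμ0 : ∀ j, 0 ≤ μ j) (hμ : Antitone μ)
    (hAB : ∀ j, IsStationary p q k β (μ j) (A j) (B j))
    {E : Matrix (Fin d) (Fin n) ℝ} (hE : E * Eᵀ = 1) {a b : Fin d → ℝ} (ha : ∀ i, 0 ≤ a i)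
    (hb : ∀ i, 0 ≤ b i) :
    ∑ i, cell p q k β (μ (Fin.castLE h i)) (A (Fin.castLE h i)) (B (Fin.castLE h i)) ≤
        ∑ i, cell p q k β (∑ j, E i j ^ 2 * μ j) (a i) (b i) ∧
      (∑ i, cell p q k β (∑ j, E i j ^ 2 * μ j) (a i) (b i) ≤
        ∑ i, cell p q k β (μ (Fin.castLE h i)) (A (Fin.castLE h i)) (B (Fin.castLE h i)) →
        ∀ i j, E i j ≠ 0 → a i = A j ∧ b i = B j) := by
  set g : Fin n → ℝ := fun j => cell p q k β (μ j) (A j) (B j) with hg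
  -- At fixed `a`, `b` a cell decreases in `s`, so its minimum does too.
  have hmono : Monotone g := by
    intro j l hjl
    refine ((hAB j).cell_le hp hk hβ (hμ0 j) (hAB l).a_nonneg (hAB l).b_nonneg).1.trans ?_
    have h1 : 0 ≤ A l / (A l + p) := div_nonneg (hAB l).a_nonneg (by linarith [(hAB l).a_nonneg])
    have := mul_le_mul_of_nonneg_right (hμ hjl) h1
    simp only [hg, cell]
    linarith
  have h1 := sum_castLE_le_sum_mul h (D := fun i j => E i j ^ 2) (fun _ _ => sq_nonneg _)
    (sum_sq_row_eq_one hE) (sum_sq_col_le_one hE) hmono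
  have e (i) : cell p q k β (∑ j, E i j ^ 2 * μ j) (a i) (b i) =
      ∑ j, E i j ^ 2 * cell p q k β (μ j) (a i) (b i) := by
    simp only [cell, mul_sub, Finset.sum_sub_distrib, ← Finset.sum_mul, sum_sq_row_eq_one hE,
      one_mul, ← mul_assoc]
  have hterm (i j) : E i j ^ 2 * g j ≤ E i j ^ 2 * cell p q k β (μ j) (a i) (b i) :=
    mul_le_mul_of_nonneg_left ((hAB j).cell_le hp hk hβ (hμ0 j) (ha i) (hb i)).1 (sq_nonneg _)
  have h2 (i) : ∑ j, E i j ^ 2 * g j ≤ ∑ j, E i j ^ 2 * cell p q k β (μ j) (a i) (b i) :=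
    Finset.sum_le_sum fun j _ => hterm i j
  simp only [e]
  have h3 := Finset.sum_le_sum fun i (_ : i ∈ Finset.univ) => h2 i
  refine ⟨h1.trans h3, fun hle i j hij => ?_⟩
  have h4 := (Finset.sum_eq_sum_iff_of_le fun i _ => h2 i).1 (le_antisymm h3 (hle.trans h1)) i
    (Finset.mem_univ i)
  have h5 := (Finset.sum_eq_sum_iff_of_le fun j _ => hterm i j).1 h4 j (Finset.mem_univ j)
  have h6 := mul_left_cancel₀ (pow_ne_zero 2 hij) h5
  exact ((hAB j).cell_le hp hk hβ (hμ0 j) (ha i) (hb i)).2 h6.ge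

end LowerBound

/-! ### Characterization of the minimizers. -/

variable {m n d : ℕ}

/-- Orthogonal diagonalization of `V Vᵀ`, as a singular value decomposition of `V`. -/
lemma exists_rotation_eq_diagonal_mul (h : d ≤ n) (V : Matrix (Fin d) (Fin n) ℝ) :
    ∃ P ∈ Matrix.orthogonalGroup (Fin d) ℝ, ∃ O ∈ Matrix.orthogonalGroup (Fin n) ℝ,
      ∃ a : Fin d → ℝ, (∀ i, 0 ≤ a i) ∧ Antitone a ∧
        Pᵀ * V = Matrix.diagonal (fun i => √(a i)) * topRows h Oᵀ := by
  obtain ⟨P, hP, a, hPa, ha⟩ := exists_orthogonal_diagonalization (H := Vᵀᵀ * Vᵀ)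
    (by simp)
  have h1 := transpose_mul_self_mul_mul hP hPa
  have h0 := nonneg_of_transpose_mul_self_eq_diagonal h1
  obtain ⟨O, hO, e⟩ := exists_orthogonal_of_mul_transpose_eq_diagonal h (Pᵀ * V)
    (fun i => √(a i)) (by simpa [Real.sq_sqrt (h0 _)] using h1)
  exact ⟨P, hP, O, hO, a, h0, ha, e⟩

/-- The resulting index is the rank of `V₁` when `a` lists its squared singular values, and
separates the directions in use from the free ones. -/
lemma exists_lt_iff_pos {a : Fin d → ℝ} (ha : Antitone a) :
    ∃ m ≤ d, ∀ i : Fin d, (i : ℕ) < m ↔ 0 < a i := by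
  classical
  have hex : ∃ m, ∀ i : Fin d, m ≤ (i : ℕ) → ¬ 0 < a i := ⟨d, fun i hi => by omega⟩
  refine ⟨Nat.find hex, Nat.find_min' hex fun i hi => by omega, fun i => ⟨fun hi => ?_, fun hi => ?_⟩⟩
  · have := Nat.find_min hex hi
    push Not at this
    obtain ⟨j, hij, hj⟩ := this
    exact hj.trans_le (ha hij)
  · by_contra hle
    exact Nat.find_spec hex i (not_lt.1 hle) hi

lemma sum_sq_mul_topRows (h : d ≤ n) {Z : Matrix (Fin m) (Fin n) ℝ} {R : Matrix (Fin n) (Fin n) ℝ}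
    (hR : R ∈ Matrix.orthogonalGroup (Fin n) ℝ) {μ : Fin n → ℝ}
    (hZ : Zᵀ * Z * R = R * Matrix.diagonal μ) (i : Fin d) :
    ∑ l, (Z * (topRows h Rᵀ)ᵀ) l i ^ 2 = μ (Fin.castLE h i) := by
  have e := congrFun₂ (transpose_mul_self_mul_mul hR hZ) (Fin.castLE h i) (Fin.castLE h i)
  rw [Matrix.diagonal_apply_eq, Matrix.mul_apply] at e
  rw [← e]
  exact Finset.sum_congr rfl fun l _ => sq _

section Minimizers

variable {p q k β : ℝ} {lam om : ℝ → ℝ}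

/-- The form that the minimizers of `energy` take, when the optimal cell at the singular value `θ`
is given by the singular values `lam θ` and `om θ`. -/
def IsOptimalForm (h : d ≤ n) (p k : ℝ) (lam om : ℝ → ℝ) (Z : Matrix (Fin m) (Fin n) ℝ)
    (U₁ : Matrix (Fin m) (Fin d) ℝ) (U : Matrix (Fin d) (Fin d) ℝ) (V : Matrix (Fin d) (Fin n) ℝ)
    (W : Matrix (Fin d) (Fin d) ℝ) (S : Matrix (Fin m) (Fin m) ℝ) (θ : Fin n → ℝ)
    (R : Matrix (Fin n) (Fin n) ℝ) (P Q : Matrix (Fin d) (Fin d) ℝ) : Prop :=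
  IsSVD Z S θ R ∧ P ∈ Matrix.orthogonalGroup (Fin d) ℝ ∧ Q ∈ Matrix.orthogonalGroup (Fin d) ℝ ∧
    V = P * rectDiag d n (fun j => lam (θ j)) * Rᵀ ∧
    U = P * rectDiag d d (fun j => om (θ (Fin.castLE h j))) * Qᵀ ∧
    W = Uᵀ * (U * Uᵀ + k • (1 : Matrix (Fin d) (Fin d) ℝ))⁻¹ ∧
    U₁ = Z * Vᵀ * (V * Vᵀ + p • (1 : Matrix (Fin d) (Fin d) ℝ))⁻¹

lemma IsOptimalForm.energy_eq (h : d ≤ n) (hn : n ≤ m) (hp : 0 < p) (hk : 0 < k)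
    {Z : Matrix (Fin m) (Fin n) ℝ}
    {U₁ : Matrix (Fin m) (Fin d) ℝ} {U : Matrix (Fin d) (Fin d) ℝ} {V : Matrix (Fin d) (Fin n) ℝ}
    {W : Matrix (Fin d) (Fin d) ℝ} {S : Matrix (Fin m) (Fin m) ℝ} {θ : Fin n → ℝ}
    {R : Matrix (Fin n) (Fin n) ℝ} {P Q : Matrix (Fin d) (Fin d) ℝ}
    (hF : IsOptimalForm h p k lam om Z U₁ U V W S θ R P Q) :
    energy p q k β Z U₁ U V W = frobSq Z + ∑ i, cell p q k β (θ (Fin.castLE h i) ^ 2)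
      (lam (θ (Fin.castLE h i)) ^ 2) (om (θ (Fin.castLE h i)) ^ 2) := by
  obtain ⟨hZ, hP, hQ, hV, hU, hW, hU₁⟩ := hF
  rw [Matrix.mul_assoc, rectDiag_mul h] at hV
  rw [rectDiag_self, Matrix.mul_assoc] at hU
  rw [energy_of_aligned hP hQ (topRows_mul_transpose h hZ.right_mem) hp hk hV hU hW hU₁]
  simp only [sum_sq_mul_topRows h hZ.right_mem (hZ.transpose_mul_self_mul hn)]

/-- Every point bounds the optimal value from above; equality forces the cells of the point to be
optimal at all singular values of `Z` in whose singular vectors they take part. -/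
lemma optimal_le_sum_cell (h : d ≤ n) (hn : n ≤ m) (hp : 0 < p) (hk : 0 < k) (hβ : 0 < β)
    (hst : ∀ θ, 0 ≤ θ → IsStationary p q k β (θ ^ 2) (lam θ ^ 2) (om θ ^ 2))
    {Z : Matrix (Fin m) (Fin n) ℝ} {S : Matrix (Fin m) (Fin m) ℝ} {θ : Fin n → ℝ}
    {R : Matrix (Fin n) (Fin n) ℝ} (hZ : IsSVD Z S θ R) {N : Matrix (Fin d) (Fin n) ℝ}
    (hN : N * Nᵀ = 1) {a b : Fin d → ℝ} (ha : ∀ i, 0 ≤ a i) (hb : ∀ i, 0 ≤ b i) :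
    ∑ i, cell p q k β (θ (Fin.castLE h i) ^ 2)
        (lam (θ (Fin.castLE h i)) ^ 2) (om (θ (Fin.castLE h i)) ^ 2) ≤
        ∑ i, cell p q k β (∑ l, (Z * Nᵀ) l i ^ 2) (a i) (b i) ∧
      (∑ i, cell p q k β (∑ l, (Z * Nᵀ) l i ^ 2) (a i) (b i) ≤
        ∑ i, cell p q k β (θ (Fin.castLE h i) ^ 2)
        (lam (θ (Fin.castLE h i)) ^ 2) (om (θ (Fin.castLE h i)) ^ 2) →
        ∀ i j, (N * R) i j ≠ 0 → a i = lam (θ j) ^ 2 ∧ b i = om (θ j) ^ 2) := by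
  have hR1 : R * Rᵀ = 1 := (Matrix.mem_orthogonalGroup_iff _ _).1 hZ.right_mem
  have hE : N * R * (N * R)ᵀ = 1 := by
    rw [Matrix.transpose_mul, Matrix.mul_assoc, ← Matrix.mul_assoc R, hR1, Matrix.one_mul, hN]
  simp only [sum_sq_mul_transpose hZ.right_mem (hZ.transpose_mul_self_mul hn)]
  exact sum_cell_ge h hp hk hβ (fun j => sq_nonneg (θ j))
    (fun i j hij => pow_le_pow_left₀ (hZ.nonneg j) (hZ.antitone hij) 2)
    (fun j => hst _ (hZ.nonneg j)) hE ha hb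

lemma IsOptimalForm.energy_le (h : d ≤ n) (hn : n ≤ m) (hp : 0 < p) (hk : 0 < k) (hβ : 0 < β)
    (hst : ∀ θ, 0 ≤ θ → IsStationary p q k β (θ ^ 2) (lam θ ^ 2) (om θ ^ 2))
    {Z : Matrix (Fin m) (Fin n) ℝ}
    {U₁ : Matrix (Fin m) (Fin d) ℝ} {U : Matrix (Fin d) (Fin d) ℝ} {V : Matrix (Fin d) (Fin n) ℝ}
    {W : Matrix (Fin d) (Fin d) ℝ} {S : Matrix (Fin m) (Fin m) ℝ} {θ : Fin n → ℝ}
    {R : Matrix (Fin n) (Fin n) ℝ} {P Q : Matrix (Fin d) (Fin d) ℝ}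
    (hF : IsOptimalForm h p k lam om Z U₁ U V W S θ R P Q) (U₁' : Matrix (Fin m) (Fin d) ℝ)
    (U' : Matrix (Fin d) (Fin d) ℝ) (V' : Matrix (Fin d) (Fin n) ℝ)
    (W' : Matrix (Fin d) (Fin d) ℝ) :
    energy p q k β Z U₁ U V W ≤ energy p q k β Z U₁' U' V' W' := by
  obtain ⟨P', hP', O, hO, a, ha, -, hV'⟩ := exists_rotation_eq_diagonal_mul h V'
  rw [hF.energy_eq h hn hp hk, ← energy_conj hP' p q k β Z U₁' U' V' W', hV',
    energy_diagonal_mul (topRows_mul_transpose h hO) hp hk, add_assoc]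
  have h1 := (optimal_le_sum_cell (q := q) h hn hp hk hβ hst hF.1 (topRows_mul_transpose h hO)
    (a := fun i => √(a i) ^ 2) (b := fun i => ∑ l, (P'ᵀ * U') i l ^ 2)
    (fun _ => sq_nonneg _) (fun _ => Finset.sum_nonneg fun _ _ => sq_nonneg _)).1
  have h2 := excess_nonneg (V := Matrix.diagonal (fun i => √(a i)) * topRows h Oᵀ)
    (a := fun i => √(a i) ^ 2) hk hβ (fun i => by positivity) Z (U₁' * P') (P'ᵀ * U') (W' * P')
  linarith

lemma exists_isSVD (hn : n ≤ m) (Z : Matrix (Fin m) (Fin n) ℝ) : ∃ S θ R, IsSVD Z S θ R := by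
  obtain ⟨R, hR, μ, hZ, hμ⟩ := exists_orthogonal_diagonalization (H := Zᵀ * Z) (by simp)
  obtain ⟨S, hS⟩ := exists_isSVD_of_eigenbasis hn hR hμ hZ
  exact ⟨S, _, R, hS⟩

/-- A leading block of directions which is optimal among all blocks of directions and all cells can
be rotated within its degenerate directions to come from a singular value decomposition. -/
lemma exists_sorted_eigenbasis (h : d ≤ n) (hn : n ≤ m) (hp : 0 < p) (hk : 0 < k) (hq : 0 < q)
    (hβ : 0 < β)
    (hst : ∀ θ, 0 ≤ θ → IsStationary p q k β (θ ^ 2) (lam θ ^ 2) (om θ ^ 2))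
    {Z : Matrix (Fin m) (Fin n) ℝ} {O : Matrix (Fin n) (Fin n) ℝ}
    (hO : O ∈ Matrix.orthogonalGroup (Fin n) ℝ) {a b : Fin d → ℝ} (ha : ∀ i, 0 ≤ a i)
    (hanti : Antitone a) (hb : ∀ i, 0 ≤ b i)
    (hmin : ∀ (N : Matrix (Fin d) (Fin n) ℝ), N * Nᵀ = 1 → ∀ a' b' : Fin d → ℝ, (∀ i, 0 ≤ a' i) →
      (∀ i, 0 ≤ b' i) → ∑ i, cell p q k β (∑ l, (Z * (topRows h Oᵀ)ᵀ) l i ^ 2) (a i) (b i) ≤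
        ∑ i, cell p q k β (∑ l, (Z * Nᵀ) l i ^ 2) (a' i) (b' i)) :
    ∃ R ∈ Matrix.orthogonalGroup (Fin n) ℝ, ∃ μ : Fin n → ℝ, Antitone μ ∧
      Zᵀ * Z * R = R * Matrix.diagonal μ ∧
      (∀ i, a i = lam √(μ (Fin.castLE h i)) ^ 2 ∧ b i = om √(μ (Fin.castLE h i)) ^ 2) ∧
      ∀ i, 0 < a i → ∀ l, R l (Fin.castLE h i) = O l (Fin.castLE h i) := by
  obtain ⟨S₀, θ, R₀, hZ⟩ := exists_isSVD hn Z
  have hZ₀ := hZ.transpose_mul_self_mul hn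
  have hbest := (optimal_le_sum_cell (q := q) h hn hp hk hβ hst hZ (topRows_mul_transpose h hO)
    ha hb).2 (by
      refine (hmin _ (topRows_mul_transpose h hZ.right_mem)
        (fun i => lam (θ (Fin.castLE h i)) ^ 2) (fun i => om (θ (Fin.castLE h i)) ^ 2)
        (fun _ => sq_nonneg _) (fun _ => sq_nonneg _)).trans_eq ?_
      simp only [sum_sq_mul_topRows h hZ.right_mem hZ₀])
  obtain ⟨r, hrd, hr⟩ := exists_lt_iff_pos hanti
  -- `τ i` is the value of `s` obtained by solving `a_eq` at `(a i, b i)`. All singular vectors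
  -- meeting direction `i` thus share one squared singular value, and the direction is an
  -- eigenvector of `Zᵀ Z`.
  set τ : Fin d → ℝ := fun i => β * k * (a i + p) ^ 2 / (p * (b i + k)) with hτ
  have hτeq (i : Fin d) (hi : 0 < a i) (j) (hij : (topRows h Oᵀ * R₀) i j ≠ 0) : θ j ^ 2 = τ i := by
    obtain ⟨e1, e2⟩ := hbest i j hij
    have h1 := (hst (θ j) (hZ.nonneg j)).a_eq (e1 ▸ hi)
    rw [← e1, ← e2] at h1
    have := hb i
    rw [hτ, eq_div_iff (by positivity)]
    linear_combination h1
  have heig : ∀ i : Fin n, (i : ℕ) < r → ∀ l, (Zᵀ * Z * O) l i =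
      (if hi : (i : ℕ) < d then τ ⟨i, hi⟩ else 0) * O l i := by
    intro i hi l
    have hid : (i : ℕ) < d := hi.trans_le hrd
    rw [dif_pos hid]
    have e1 : Zᵀ * Z * O = R₀ * (Matrix.diagonal (fun j => θ j ^ 2) * (R₀ᵀ * O)) := by
      rw [← Matrix.mul_assoc R₀, ← hZ₀, Matrix.mul_assoc (Zᵀ * Z), orthogonal_mul_transpose_cancel hZ.right_mem]
    have e2 : O l i = (R₀ * (R₀ᵀ * O)) l i := by
      rw [orthogonal_mul_transpose_cancel hZ.right_mem]
    rw [e1, e2, Matrix.mul_apply, Matrix.mul_apply, Finset.mul_sum]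
    refine Finset.sum_congr rfl fun j _ => ?_
    rw [Matrix.diagonal_mul]
    have e3 : (R₀ᵀ * O) j i = (topRows h Oᵀ * R₀) ⟨i, hid⟩ j := by
      simp only [Matrix.mul_apply, topRows_apply, Matrix.transpose_apply]
      exact Finset.sum_congr rfl fun _ _ => mul_comm _ _
    by_cases hz : (R₀ᵀ * O) j i = 0
    · simp [hz]
    · rw [hτeq ⟨i, hid⟩ ((hr ⟨i, hid⟩).1 hi) j (e3 ▸ hz)]
      ring
  obtain ⟨R, hR, μ, hZR, hRO, hμ⟩ := exists_orthogonal_diagonalization_extension (hrd.trans h)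
    (H := Zᵀ * Z) (by simp) hO heig
  have hμ0 := nonneg_of_transpose_mul_self_eq_diagonal (transpose_mul_self_mul_mul hR hZR)
  have hcol (i : Fin d) (hi : 0 < a i) (l) : R l (Fin.castLE h i) = O l (Fin.castLE h i) :=
    hRO _ ((hr i).2 hi) l
  -- Any `d` distinct columns of `R` are admissible directions. Replacing the columns of `O` by
  -- those of `R` leaves the optimal value unchanged, since they differ only where `a i = 0`.
  have hperm (s : Fin d → Fin n) (hs : Function.Injective s) (a' b' : Fin d → ℝ)
      (ha' : ∀ i, 0 ≤ a' i) (hb' : ∀ i, 0 ≤ b' i) :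
      ∑ i, cell p q k β (μ (Fin.castLE h i)) (a i) (b i) ≤
        ∑ i, cell p q k β (μ (s i)) (a' i) (b' i) := by
    have hR2 : Rᵀ * R = 1 := (Matrix.mem_orthogonalGroup_iff' _ _).1 hR
    have hN : (R.submatrix id s)ᵀ * (R.submatrix id s)ᵀᵀ = 1 := by
      ext i j
      have := congrFun₂ hR2 (s i) (s j)
      simpa [Matrix.mul_apply, Matrix.one_apply, hs.eq_iff] using this
    have key := hmin _ hN a' b' ha' hb'
    have e1 (i) : ∑ l, (Z * (R.submatrix id s)ᵀᵀ) l i ^ 2 = μ (s i) := by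
      have := congrFun₂ (transpose_mul_self_mul_mul hR hZR) (s i) (s i)
      rw [Matrix.diagonal_apply_eq, Matrix.mul_apply] at this
      rw [← this]
      exact Finset.sum_congr rfl fun l _ => sq _
    have e2 (i) : cell p q k β (∑ l, (Z * (topRows h Oᵀ)ᵀ) l i ^ 2) (a i) (b i) =
        cell p q k β (μ (Fin.castLE h i)) (a i) (b i) := by
      rcases (ha i).eq_or_lt with h0 | h0
      · rw [← h0]; exact cell_zero _ _ _ _ _ _ _
      · rw [← sum_sq_mul_topRows h hR hZR]
        congr 1
        refine Finset.sum_congr rfl fun l _ => ?_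
        simp only [Matrix.mul_apply, Matrix.transpose_apply, topRows_apply, hcol i h0]
    simpa only [e1, e2] using key
  have hstat (j) : IsStationary p q k β (μ j) (lam √(μ j) ^ 2) (om √(μ j) ^ 2) := by
    have := hst √(μ j) (Real.sqrt_nonneg _)
    rwa [Real.sq_sqrt (hμ0 j)] at this
  have hcell : ∀ i, a i = lam √(μ (Fin.castLE h i)) ^ 2 ∧ b i = om √(μ (Fin.castLE h i)) ^ 2 := by
    have hle (i : Fin d) := (hstat (Fin.castLE h i)).cell_le hp hk hβ (hμ0 _) (ha i) (hb i)
    have hsum := hperm _ (Fin.castLE_injective h) (fun i => lam √(μ (Fin.castLE h i)) ^ 2)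
      (fun i => om √(μ (Fin.castLE h i)) ^ 2) (fun _ => sq_nonneg _) (fun _ => sq_nonneg _)
    have heq := (Finset.sum_eq_sum_iff_of_le fun i _ => (hle i).1).1
      (le_antisymm (Finset.sum_le_sum fun i _ => (hle i).1) hsum)
    exact fun i => (hle i).2 (heq i (Finset.mem_univ i)).ge
  -- Exchange the used direction `i` with an unused one: all other cells keep their values, and
  -- optimality compares the two eigenvalues.
  have hswap (i : Fin d) (hi : 0 < a i) (j : Fin n) (hj : r ≤ (j : ℕ)) :
      μ j ≤ μ (Fin.castLE h i) := by
    have hij : (i : ℕ) < r := (hr i).2 hi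
    have hsum := hperm (Equiv.swap (Fin.castLE h i) j ∘ Fin.castLE h)
      ((Equiv.injective _).comp (Fin.castLE_injective h)) a b ha hb
    rw [← sub_nonneg, ← Finset.sum_sub_distrib, Finset.sum_eq_single i] at hsum
    · simp only [Function.comp_apply, Equiv.swap_apply_left, cell] at hsum
      have hpos : 0 < a i / (a i + p) := by positivity
      have : μ j * (a i / (a i + p)) ≤ μ (Fin.castLE h i) * (a i / (a i + p)) := by linarith
      exact le_of_mul_le_mul_right this hpos
    · intro l _ hl
      by_cases hlj : Fin.castLE h l = j
      · have : ¬ 0 < a l := fun hpos => by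
          have := (hr l).2 hpos
          rw [← hlj, Fin.val_castLE] at hj
          omega
        have h0 : a l = 0 := le_antisymm (not_lt.1 this) (ha l)
        rw [h0, sub_eq_zero]
        exact cell_zero _ _ _ _ _ _ _
      · rw [Function.comp_apply,
          Equiv.swap_apply_of_ne_of_ne ((Fin.castLE_injective h).ne hl) hlj, sub_self]
    · simp
  refine ⟨R, hR, μ, ?_, hZR, hcell, hcol⟩
  intro i j hij
  rcases lt_or_ge (i : ℕ) r with hi | hi
  · obtain ⟨i, rfl⟩ : ∃ i', i = Fin.castLE h i' := ⟨⟨i, hi.trans_le hrd⟩, rfl⟩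
    have hia := (hr i).1 hi
    rcases lt_or_ge (j : ℕ) r with hj | hj
    · obtain ⟨j, rfl⟩ : ∃ j', j = Fin.castLE h j' := ⟨⟨j, hj.trans_le hrd⟩, rfl⟩
      have hja := (hr j).1 hj
      refine (hstat (Fin.castLE h i)).le_of_le hp hq hk hβ (hstat (Fin.castLE h j)) ?_ ?_
      · rwa [← (hcell j).1]
      · rw [← (hcell j).1, ← (hcell i).1]
        exact hanti hij
    · exact hswap i hia j hj
  · exact hμ i j hi hij

/-- Global minimizers of `energy` have the optimal form. -/
lemma exists_isOptimalForm (h : d ≤ n) (hn : n ≤ m) (hp : 0 < p) (hk : 0 < k) (hq : 0 < q)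
    (hβ : 0 < β) (hlam : ∀ θ, 0 ≤ lam θ) (hom : ∀ θ, 0 ≤ om θ)
    (hst : ∀ θ, 0 ≤ θ → IsStationary p q k β (θ ^ 2) (lam θ ^ 2) (om θ ^ 2))
    {Z : Matrix (Fin m) (Fin n) ℝ}
    {U₁ : Matrix (Fin m) (Fin d) ℝ} {U : Matrix (Fin d) (Fin d) ℝ} {V : Matrix (Fin d) (Fin n) ℝ}
    {W : Matrix (Fin d) (Fin d) ℝ}
    (hmin : ∀ (U₁' : Matrix (Fin m) (Fin d) ℝ) (U' : Matrix (Fin d) (Fin d) ℝ)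
      (V' : Matrix (Fin d) (Fin n) ℝ) (W' : Matrix (Fin d) (Fin d) ℝ),
      energy p q k β Z U₁ U V W ≤ energy p q k β Z U₁' U' V' W') :
    ∃ S θ R P Q, IsOptimalForm h p k lam om Z U₁ U V W S θ R P Q := by
  obtain ⟨P, hP, O, hO, a, ha, hanti, hV⟩ := exists_rotation_eq_diagonal_mul h V
  have hNO := topRows_mul_transpose h hO
  set b : Fin d → ℝ := fun i => ∑ l, (Pᵀ * U) i l ^ 2 with hbdef
  have hb (i) : 0 ≤ b i := Finset.sum_nonneg fun _ _ => sq_nonneg _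
  have hsq (i) : √(a i) ^ 2 = a i := Real.sq_sqrt (ha i)
  have hval := energy_diagonal_mul (q := q) (β := β) hNO hp hk Z (U₁ * P) (Pᵀ * U) (W * P)
    (fun i => √(a i))
  rw [← hV, energy_conj hP] at hval
  simp only [hsq] at hval
  have hpos (i) : 0 < a i + p := by linarith [ha i]
  have hex := excess_nonneg (V := Pᵀ * V) hk hβ hpos Z (U₁ * P) (Pᵀ * U) (W * P)
  -- Taking both rotations to be 1 realizes any orthonormal `N` and nonnegative `a'`, `b'` with zero
  -- excess.
  have hcand (N : Matrix (Fin d) (Fin n) ℝ) (hN : N * Nᵀ = 1) (a' b' : Fin d → ℝ)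
      (ha' : ∀ i, 0 ≤ a' i) (hb' : ∀ i, 0 ≤ b' i) :
      energy p q k β Z U₁ U V W ≤ frobSq Z +
        ∑ i, cell p q k β (∑ l, (Z * Nᵀ) l i ^ 2) (a' i) (b' i) := by
    refine (hmin _ _ _ _).trans_eq ((energy_of_aligned (one_mem _) (one_mem _) hN hp hk
      (lam := fun i => √(a' i)) (om := fun i => √(b' i)) rfl rfl rfl rfl).trans ?_)
    simp only [Real.sq_sqrt (ha' _), Real.sq_sqrt (hb' _)]
  -- The candidate with the same directions and cells has the same energy without the excess.
  have hzero : excess p k β Z a (U₁ * P) (Pᵀ * U) (Pᵀ * V) (W * P) = 0 := by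
    have := hcand _ hNO a b ha hb
    linarith
  obtain ⟨hU₁P, hWP, hUU⟩ := excess_eq_zero hk hβ hpos hzero
  obtain ⟨R, hR, μ, hμ, hZR, hcell, hcol⟩ := exists_sorted_eigenbasis h hn hp hk hq hβ hst hO ha
    hanti hb fun N hN a' b' ha' hb' => by
      have := hcand N hN a' b' ha' hb'
      linarith
  obtain ⟨S, hS⟩ := exists_isSVD_of_eigenbasis hn hR hμ hZR
  have hUUd : Pᵀ * U * (Pᵀ * U)ᵀ = Matrix.diagonal b := by
    ext i j
    by_cases hij : i = j
    · subst hij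
      rw [Matrix.diagonal_apply_eq, Matrix.mul_apply]
      exact Finset.sum_congr rfl fun _ _ => by rw [Matrix.transpose_apply, sq]
    · rw [hUU j i (Ne.symm hij), Matrix.diagonal_apply_ne _ hij]
  obtain ⟨Q, hQ, hUQ⟩ := exists_orthogonal_of_mul_transpose_eq_diagonal le_rfl (Pᵀ * U)
    (fun i => √(b i)) (by simpa only [Real.sq_sqrt (hb _)] using hUUd)
  have hQtop : topRows le_rfl Qᵀ = Qᵀ := rfl
  have hVV : Pᵀ * V * (Pᵀ * V)ᵀ = Matrix.diagonal a := by
    rw [hV, diagonal_mul_mul_transpose hNO]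
    simp only [hsq]
  refine ⟨S, _, R, P, Q, hS, hP, hQ, ?_, ?_, ?_, ?_⟩
  · rw [Matrix.mul_assoc, rectDiag_mul h, ← orthogonal_mul_transpose_cancel hP V, hV]
    congr 1
    ext i l
    rw [Matrix.diagonal_mul, Matrix.diagonal_mul, (hcell i).1, Real.sqrt_sq (hlam _)]
    -- Columns of `R` and `O` may differ only where `a i = 0`, and there both rows vanish.
    rcases (ha i).eq_or_lt with h0 | h0
    · have : lam √(μ (Fin.castLE h i)) = 0 := by
        have := (hcell i).1
        rw [← h0] at this
        exact pow_eq_zero_iff two_ne_zero |>.1 this.symm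
      rw [this, zero_mul, zero_mul]
    · simp only [topRows_apply, Matrix.transpose_apply, hcol i h0]
  · rw [Matrix.mul_assoc, rectDiag_self, ← orthogonal_mul_transpose_cancel hP U, hUQ, hQtop]
    congr 3
    ext i
    rw [(hcell i).2, Real.sqrt_sq (hom _)]
  · have := (eq_mul_transpose_mul_inv_iff (p := k) hP hUUd
      (fun i => (add_pos_of_nonneg_of_pos (hb i) hk).ne') 1 W).2 (by
        rw [Matrix.one_mul]; exact hWP)
    rwa [Matrix.one_mul] at this
  · exact (eq_mul_transpose_mul_inv_iff hP hVV (fun i => (hpos i).ne') Z U₁).2 hU₁P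

end Minimizers

end MHVAE
end

theorem theorem5 {D₀ d₀ d₁ d₂ : ℕ} (hD : d₀ ≤ D₀) (h₀₁ : d₁ ≤ d₀) (h₁₂ : d₁ = d₂)
    (ηdec ηenc β₁ β₂ σ₁ σ₂ c : ℝ) (hηdec : 0 < ηdec) (hηenc : 0 < ηenc)
    (hβ₁ : 0 < β₁) (hβ₂ : 0 < β₂) (hσ₁ : 0 < σ₁) (hσ₂ : 0 < σ₂) (hc : c = ηdec / ηenc)
    (Z : Matrix (Fin D₀) (Fin d₀) ℝ)
    (U₁ : Matrix (Fin D₀) (Fin d₁) ℝ) (U₂ : Matrix (Fin d₁) (Fin d₂) ℝ)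
    (V₁ : Matrix (Fin d₁) (Fin d₀) ℝ) (W₂ : Matrix (Fin d₂) (Fin d₁) ℝ) :
    (∀ (U₁' : Matrix (Fin D₀) (Fin d₁) ℝ) (U₂' : Matrix (Fin d₁) (Fin d₂) ℝ)
        (V₁' : Matrix (Fin d₁) (Fin d₀) ℝ) (W₂' : Matrix (Fin d₂) (Fin d₁) ℝ),
        MHVAE.loss ηdec ηenc β₁ β₂ Z (σ₁ ^ 2 • 1) (σ₂ ^ 2 • 1) U₁ U₂ V₁ W₂ ≤
          MHVAE.loss ηdec ηenc β₁ β₂ Z (σ₁ ^ 2 • 1) (σ₂ ^ 2 • 1) U₁' U₂' V₁' W₂') ↔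
      ∃ (S : Matrix (Fin D₀) (Fin D₀) ℝ) (θ : Fin d₀ → ℝ) (R : Matrix (Fin d₀) (Fin d₀) ℝ)
        (P : Matrix (Fin d₁) (Fin d₁) ℝ) (Q : Matrix (Fin d₂) (Fin d₂) ℝ),
        MHVAE.IsSVD Z S θ R ∧
        P ∈ Matrix.orthogonalGroup (Fin d₁) ℝ ∧
        Q ∈ Matrix.orthogonalGroup (Fin d₂) ℝ ∧
        V₁ = P * MHVAE.rectDiag d₁ d₀ (fun j => MHVAE.lamStar β₁ β₂ c σ₁ σ₂ (θ j)) * Rᵀ ∧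
        U₂ = P * MHVAE.rectDiag d₁ d₂
          (fun j => MHVAE.omStar β₁ β₂ c σ₁ σ₂ (θ (Fin.castLE (h₁₂.symm.le.trans h₀₁) j))) * Qᵀ ∧
        W₂ = U₂ᵀ * (U₂ * U₂ᵀ + (β₂ / β₁ * c ^ 2) • (1 : Matrix (Fin d₁) (Fin d₁) ℝ))⁻¹ ∧
        U₁ = Z * V₁ᵀ * (V₁ * V₁ᵀ + σ₁ ^ 2 • (1 : Matrix (Fin d₁) (Fin d₁) ℝ))⁻¹ := by
  subst h₁₂
  have hcpos : 0 < c := hc ▸ div_pos hηdec hηenc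
  have hk : 0 < β₂ / β₁ * c ^ 2 := by positivity
  have hp : 0 < σ₁ ^ 2 := by positivity
  have hq : 0 < σ₂ ^ 2 := by positivity
  simp only [MHVAE.loss_le_loss_iff hηdec hβ₁ hc]
  constructor
  · intro hmin
    exact MHVAE.exists_isOptimalForm h₀₁ hD hp hk hq hβ₁ (MHVAE.lamStar_nonneg hcpos hσ₂)
      (MHVAE.omStar_nonneg hβ₁ hcpos hσ₁)
      (fun θ => MHVAE.isStationary_star hβ₁ hβ₂ hcpos hσ₁ hσ₂) hmin
  · rintro ⟨S, θ, R, P, Q, hF⟩ U₁' U₂' V₁' W₂'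
    exact MHVAE.IsOptimalForm.energy_le h₀₁ hD hp hk hβ₁
      (fun θ => MHVAE.isStationary_star hβ₁ hβ₂ hcpos hσ₁ hσ₂) hF U₁' U₂' V₁' W₂'
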